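/- Let $L=D-A$, $\mathcal L=D^{-1/2}LD^{-1/2}$ and $\Delta=D^{-1}L$ be the combinatorial Laplacian, the normalized Laplacian and the discrete Laplace operator of a finite graph with adjacency matrix $A$ and degree matrix $D$. Its normalized Green's function is $\mathcal G=\sum_{\lambda_j>0}\lambda_j^{-1}\phi_j\phi_j^*$, where $(\lambda_j,\phi_j)$ is an orthonormal eigensystem of $\mathcal L$; the Green's functions belonging to $L$, $\mathcal L$, $\Delta$ are $D^{-1/2}\mathcal G D^{-1/2}$, $\mathcal G$ and $D^{-1/2}\mathcal G D^{1/2}$, respectively. The machine model is a real RAM: a program has a memory of $w$-bit words and a memory of real numbers, both with indirect addressing; each of the following takes one step: an arithmetic operation or comparison on words, a memory access, an exact operation $+,-,\times,\div,\sqrt{\cdot},\cos$ on real numbers, the constant $\pi$, the conversion of a word to a real number, a comparison of two real numbers. **Corollary.** For each of the three Laplacians there are a program $P$, a natural number $c$ and a constant $C$ such that the following holds for all $t\ge 1$, all $m_1,\dots,m_t\ge 3$, $n=\prod_{s=1}^t m_s$, and every word length $w\ge c\log_2 n$. Started on the input $t,m_1,\dots,m_t$, the program $P$ halts after at most $$C\,t\,n^{2-1/t}\log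 n$$ steps with $n$ real numbers $g(z)$, $z\in\prod_{s=1}^t\{0,\dots,m_s-1\}$, in its memory (in mixed radix order), such that the matrix $$X\big((x_1,\dots,x_t),(y_1,\dots,y_t)\big)=g\big(|y_1-x_1|,\dots,|y_t-x_t|\big)$$ is the Green's function of the $t$-dimensional torus $C_{m_1}\times\cdots\times C_{m_t}$ (the Cartesian product of cycles) that belongs to the chosen Laplacian, and is the Moore–Penrose pseudo-inverse of that Laplacian. (Thus the pseudo-inverse is determined through its first row; the full $n\times n$ matrix is not written out.) -/

import Mathlib

/-! ### Laplacians, Green's functions and pseudo-inverses of finite graphs -/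

/-- The three Laplacians of a graph: `L = D - A`, `𝓛 = D^{-1/2} L D^{-1/2}`, `Δ = D^{-1} L`. -/
inductive LaplacianKind
  | combinatorial
  | normalized
  | discrete

section Laplacians

variable {V : Type*} [Fintype V] [DecidableEq V] (Γ : SimpleGraph V) [DecidableRel Γ.Adj]

/-- The normalized Laplacian `𝓛`. -/
noncomputable def normalizedLaplacian : Matrix V V ℝ :=
  Matrix.of fun x y =>
    if x = y then 1
    else if Γ.Adj x y then -1 / Real.sqrt ((Γ.degree x : ℝ) * (Γ.degree y : ℝ))
    else 0

/-- The discrete Laplace operator `Δ`. -/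
noncomputable def discreteLaplacian : Matrix V V ℝ :=
  Matrix.of fun x y =>
    if x = y then 1
    else if Γ.Adj x y then -1 / (Γ.degree x : ℝ)
    else 0

noncomputable def laplacian : LaplacianKind → Matrix V V ℝ
  | .combinatorial => Γ.lapMatrix ℝ
  | .normalized => normalizedLaplacian Γ
  | .discrete => discreteLaplacian Γ

theorem normalizedLaplacian_isHermitian : (normalizedLaplacian Γ).IsHermitian := by
  ext x y
  simp only [normalizedLaplacian, Matrix.conjTranspose_apply, Matrix.of_apply, star_trivial,
    eq_comm (a := y) (b := x), Γ.adj_comm y x, mul_comm (Γ.degree y : ℝ)]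

/-- The normalized Green's function `𝓖 = ∑_{λ_j > 0} λ_j⁻¹ φ_j φ_j^*`, where `(λ_j, φ_j)` is an
orthonormal eigensystem of the normalized Laplacian. -/
noncomputable def normalizedGreen : Matrix V V ℝ :=
  Matrix.of fun x y =>
    ∑ j : V,
      if 0 < (normalizedLaplacian_isHermitian Γ).eigenvalues j then
        1 / (normalizedLaplacian_isHermitian Γ).eigenvalues j
          * ((normalizedLaplacian_isHermitian Γ).eigenvectorBasis j x
            * (normalizedLaplacian_isHermitian Γ).eigenvectorBasis j y)
      else 0

/-- The Green's functions that belong to `L`, `𝓛` and `Δ`: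
`D^{-1/2} 𝓖 D^{-1/2}`, `𝓖` and `D^{-1/2} 𝓖 D^{1/2}`. -/
noncomputable def greenFunction : LaplacianKind → Matrix V V ℝ
  | .combinatorial => Matrix.of fun x y =>
      normalizedGreen Γ x y / (Real.sqrt (Γ.degree x) * Real.sqrt (Γ.degree y))
  | .normalized => normalizedGreen Γ
  | .discrete => Matrix.of fun x y =>
      normalizedGreen Γ x y * Real.sqrt (Γ.degree y) / Real.sqrt (Γ.degree x)

end Laplacians

/-- `X` is the (Moore–Penrose) pseudo-inverse of the real matrix `A`. -/
structure IsPseudoInverse {V : Type*} [Fintype V] (A X : Matrix V V ℝ) : Prop where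
  mul_mul_self : A * X * A = A
  self_mul_mul : X * A * X = X
  symm_left : (A * X).transpose = A * X
  symm_right : (X * A).transpose = X * A

/-! ### The torus -/

/-- The torus `C_{m 0} × ⋯ × C_{m (t-1)}`, the Cartesian product of cycles. -/
def torus {t : ℕ} (m : Fin t → ℕ) : SimpleGraph (∀ s, Fin (m s)) where
  Adj x y := ∃ s, (SimpleGraph.cycleGraph (m s)).Adj (x s) (y s) ∧ ∀ r, r ≠ s → x r = y r
  symm := ⟨fun _ _ ⟨s, h, h'⟩ => ⟨s, h.symm, fun r hr => (h' r hr).symm⟩⟩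
  loopless := ⟨fun _ ⟨_, h, _⟩ => h.ne rfl⟩

instance {t : ℕ} (m : Fin t → ℕ) : DecidableRel (torus m).Adj := fun x y =>
  inferInstanceAs (Decidable
    (∃ s, (SimpleGraph.cycleGraph (m s)).Adj (x s) (y s) ∧ ∀ r, r ≠ s → x r = y r))

/-- The vertex `(|y_1 - x_1|, …, |y_t - x_t|)`. -/
def absDiff {t : ℕ} {m : Fin t → ℕ} (x y : ∀ s, Fin (m s)) : ∀ s, Fin (m s) :=
  fun s => ⟨((y s : ℕ) - (x s : ℕ)) + ((x s : ℕ) - (y s : ℕ)), by omega⟩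

/-! ### The real RAM

A random access machine with two memories: one holds words of `w` bits, the other one holds real
numbers.  Every elementary operation on words or on real numbers takes one step.  A real number can
influence the words only through a comparison of two real numbers. -/

namespace RealRAM

/-- Word expressions; `load a` is the content of the word memory at the address `a`. -/
inductive WordExpr
  | const (k : ℕ)
  | load (a : WordExpr)
  | add (a b : WordExpr)
  | sub (a b : WordExpr)
  | mul (a b : WordExpr)
  | div (a b : WordExpr)
  | mod (a b : WordExpr)
  | lt (a b : WordExpr)

/-- Real expressions; `load a` is the content of the real memory at the address `a`. -/
inductive RealExpr
  | ofWord (a : WordExpr)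
  | load (a : WordExpr)
  | pi
  | add (a b : RealExpr)
  | sub (a b : RealExpr)
  | mul (a b : RealExpr)
  | div (a b : RealExpr)
  | sqrt (a : RealExpr)
  | cos (a : RealExpr)

/-- Programs: assignments to a memory cell, sequencing, branching and loops. -/
inductive Program
  | setWord (addr val : WordExpr)
  | setReal (addr : WordExpr) (val : RealExpr)
  | seq (p q : Program)
  | ifWord (a : WordExpr) (p q : Program)
  | ifLess (a b : RealExpr) (p q : Program)
  | while (a : WordExpr) (p : Program)

/-- The contents of the two memories. -/
structure State where
  word : ℕ → ℕ
  real : ℕ → ℝ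

/-- The value of a word expression; words have `w` bits, so it is reduced modulo `2 ^ w`. -/
def WordExpr.eval (w : ℕ) (σ : State) : WordExpr → ℕ
  | const k => k % 2 ^ w
  | load a => σ.word (a.eval w σ) % 2 ^ w
  | add a b => (a.eval w σ + b.eval w σ) % 2 ^ w
  | sub a b => a.eval w σ - b.eval w σ
  | mul a b => (a.eval w σ * b.eval w σ) % 2 ^ w
  | div a b => a.eval w σ / b.eval w σ
  | mod a b => a.eval w σ % b.eval w σ
  | lt a b => (if a.eval w σ < b.eval w σ then 1 else 0) % 2 ^ w

noncomputable def RealExpr.eval (w : ℕ) (σ : State) : RealExpr → ℝ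
  | ofWord a => (a.eval w σ : ℝ)
  | load a => σ.real (a.eval w σ)
  | pi => Real.pi
  | add a b => a.eval w σ + b.eval w σ
  | sub a b => a.eval w σ - b.eval w σ
  | mul a b => a.eval w σ * b.eval w σ
  | div a b => a.eval w σ / b.eval w σ
  | sqrt a => Real.sqrt (a.eval w σ)
  | cos a => Real.cos (a.eval w σ)

/-- The number of elementary operations in the evaluation of a word expression. -/
def WordExpr.cost : WordExpr → ℕ
  | const _ => 1
  | load a => a.cost + 1
  | add a b | sub a b | mul a b | div a b | mod a b | lt a b => a.cost + b.cost + 1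

/-- The number of elementary operations in the evaluation of a real expression. -/
def RealExpr.cost : RealExpr → ℕ
  | ofWord a | load a => a.cost + 1
  | pi => 1
  | add a b | sub a b | mul a b | div a b => a.cost + b.cost + 1
  | sqrt a | cos a => a.cost + 1

/-- `Exec w p σ σ' k`: on words of `w` bits, the program `p`, started in the state `σ`, halts in
the state `σ'` after exactly `k` steps.  A nonzero word counts as true. -/
inductive Exec (w : ℕ) : Program → State → State → ℕ → Prop
  | setWord (a v : WordExpr) (σ : State) :
      Exec w (.setWord a v) σ
        ⟨Function.update σ.word (a.eval w σ) (v.eval w σ), σ.real⟩ (a.cost + v.cost + 1)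
  | setReal (a : WordExpr) (v : RealExpr) (σ : State) :
      Exec w (.setReal a v) σ
        ⟨σ.word, Function.update σ.real (a.eval w σ) (v.eval w σ)⟩ (a.cost + v.cost + 1)
  | seq {p q : Program} {σ σ' σ'' : State} {k l : ℕ} :
      Exec w p σ σ' k → Exec w q σ' σ'' l → Exec w (.seq p q) σ σ'' (k + l)
  | ifWord_true {a : WordExpr} {p q : Program} {σ σ' : State} {k : ℕ} :
      a.eval w σ ≠ 0 → Exec w p σ σ' k → Exec w (.ifWord a p q) σ σ' (a.cost + 1 + k)
  | ifWord_false {a : WordExpr} {p q : Program} {σ σ' : State} {k : ℕ} :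
      a.eval w σ = 0 → Exec w q σ σ' k → Exec w (.ifWord a p q) σ σ' (a.cost + 1 + k)
  | ifLess_true {a b : RealExpr} {p q : Program} {σ σ' : State} {k : ℕ} :
      a.eval w σ < b.eval w σ → Exec w p σ σ' k →
        Exec w (.ifLess a b p q) σ σ' (a.cost + b.cost + 1 + k)
  | ifLess_false {a b : RealExpr} {p q : Program} {σ σ' : State} {k : ℕ} :
      ¬ a.eval w σ < b.eval w σ → Exec w q σ σ' k →
        Exec w (.ifLess a b p q) σ σ' (a.cost + b.cost + 1 + k)
  | while_true {a : WordExpr} {p : Program} {σ σ' σ'' : State} {k l : ℕ} :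
      a.eval w σ ≠ 0 → Exec w p σ σ' k → Exec w (.while a p) σ' σ'' l →
        Exec w (.while a p) σ σ'' (a.cost + 1 + k + l)
  | while_false {a : WordExpr} {p : Program} {σ : State} :
      a.eval w σ = 0 → Exec w (.while a p) σ σ (a.cost + 1)

/-- The input: the words `t, m 0, …, m (t-1)` at the addresses `0, 1, …, t`; all other cells
contain `0`. -/
def inputState {t : ℕ} (m : Fin t → ℕ) : State where
  word a := if a = 0 then t else if h : a - 1 < t then m ⟨a - 1, h⟩ else 0
  real _ := 0

end RealRAM

/-- The matrix that is represented by its first row, with the row stored in the real memory of `σ`: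
the entry at `(x, y)` is the content of the cell whose address is the mixed radix number
`∑ s, |y s - x s| * ∏ r < s, m r`. -/
def matrixOfRow {t : ℕ} (m : Fin t → ℕ) (σ : RealRAM.State) :
    Matrix (∀ s, Fin (m s)) (∀ s, Fin (m s)) ℝ :=
  Matrix.of fun x y => σ.real (finPiFinEquiv (absDiff x y))

/-! ### Pseudo-inverses and spectral Green's functions -/

/-! The torus is `2 * t`-regular, so $D$ is a scalar matrix and the three Laplacians are multiples
of $L$. The spectral sum is the pseudo-inverse of the normalized Laplacian, and pseudo-inverses are
unique. Hence any explicit pseudo-inverse of $L$ yields all three Green's functions up to the factor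
$1$ or $2t$ (`greenFunction_of_regular`).

For $L$, single out a longest direction $J$ and diagonalize only the other directions, by products
of cosines. On the mode $k$ they act as the scalar $\mu_k$ (`modeEigenvalue`), and what remains is
to invert $L_{C}+\mu_k$ on the cycle in direction $J$. This has a closed form: with $r+1/r=2+\mu_k$,
$0<r<1$, a multiple of $r^d+r^{m-d}$ at distance $d$ (`cycleResolvent`), and for $\mu_k=0$ a
quadratic polynomial of mean zero (`cycleGreen`). Everything depends on coordinate distances only,
because cosines and both closed forms are invariant under $d\mapsto m-d$. Orthogonality of the
cosines shows that the sum over the modes, `torusGreen`, satisfies $GL=1-\frac1n\mathbf 1\mathbf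
1^T$ and has vanishing row sums, which characterizes the pseudo-inverse of $L$.

Summing directly over the $n/m_J$ modes at each of the $n$ vertices, with $O(t)$ operations for each
pair, costs $O(t\,n^2/m_J)$ once the powers of $r$ are tabulated for each mode. The longest cycle
has length at least the geometric mean $n^{1/t}$, which gives $O(t\,n^{2-1/t})$; the logarithm is
slack.

The machine part follows a record `Mem` of named variables, embedded in the two memories by `enc`.
Each piece of the program is a map between such records with a step bound (`Steps`).
`steps_greenProgram` assembles the pieces, and `sum_contribution` identifies the computed sums with
`torusRow`. -/

theorem IsPseudoInverse.unique {V : Type*} [Fintype V] {A X Y : Matrix V V ℝ}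
    (hX : IsPseudoInverse A X) (hY : IsPseudoInverse A Y) : X = Y := by
  -- `A * X` and `A * Y` are symmetric projections onto the range of `A`; each absorbs the other,
  -- and transposing the product shows that they agree.
  have h1 : A * X = A * Y := by
    have : A * Y * (A * X) = A * X := by rw [← Matrix.mul_assoc, hY.mul_mul_self]
    rw [← hX.symm_left, ← this, Matrix.transpose_mul, hX.symm_left, hY.symm_left,
      ← Matrix.mul_assoc, hX.mul_mul_self]
  have h2 : X * A = Y * A := by
    have : X * A * (Y * A) = X * A := by
      rw [Matrix.mul_assoc, ← Matrix.mul_assoc A, hY.mul_mul_self]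
    rw [← hX.symm_right, ← this, Matrix.transpose_mul, hX.symm_right, hY.symm_right,
      Matrix.mul_assoc, ← Matrix.mul_assoc A, hX.mul_mul_self]
  calc X = X * A * X := hX.self_mul_mul.symm
    _ = Y * A * Y := by rw [h2, Matrix.mul_assoc, h1, ← Matrix.mul_assoc]
    _ = Y := hY.self_mul_mul

theorem IsPseudoInverse.smul {V : Type*} [Fintype V] {A X : Matrix V V ℝ}
    (h : IsPseudoInverse A X) {a : ℝ} (ha : a ≠ 0) : IsPseudoInverse (a • A) (a⁻¹ • X) := by
  constructor <;> simp [smul_smul, ha, h.mul_mul_self, h.self_mul_mul, h.symm_left, h.symm_right]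

/-- A symmetric matrix `X` that inverts `A` up to the projection onto a common null vector. -/
theorem IsPseudoInverse.of_mul_eq {V : Type*} [Fintype V] [DecidableEq V]
    {A X Q : Matrix V V ℝ} (hA : A.transpose = A) (hX : X.transpose = X) (hQ : Q.transpose = Q)
    (hQA : Q * A = 0) (hXQ : X * Q = 0) (h : A * X = 1 - Q) : IsPseudoInverse A X := by
  have h' : X * A = 1 - Q := by
    rw [← hX, ← hA, ← Matrix.transpose_mul, h, Matrix.transpose_sub, hQ, Matrix.transpose_one]
  constructor
  · rw [h, sub_mul, hQA, one_mul, sub_zero]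
  · rw [Matrix.mul_assoc, h, mul_sub, hXQ, mul_one, sub_zero]
  · rw [h, Matrix.transpose_sub, hQ, Matrix.transpose_one]
  · rw [h', Matrix.transpose_sub, hQ, Matrix.transpose_one]

/-! ### The spectral Green's function, and the three Laplacians of a regular graph -/

section Regular

variable {V : Type*} [Fintype V] [DecidableEq V] (Γ : SimpleGraph V) [DecidableRel Γ.Adj]

/-- In an orthonormal eigenbasis both matrices are diagonal, with entries `ev j` and `(ev j)⁻¹`. The
convention `0⁻¹ = 0` gives the null space the right entries, and nonnegativity ensures that the
condition `0 <` discards only zero eigenvalues. -/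
theorem normalizedGreen_isPseudoInverse
    (hpos : ∀ j, 0 ≤ (normalizedLaplacian_isHermitian Γ).eigenvalues j) :
    IsPseudoInverse (normalizedLaplacian Γ) (normalizedGreen Γ) := by
  set hH := normalizedLaplacian_isHermitian Γ
  set U : Matrix V V ℝ := (hH.eigenvectorUnitary : Matrix V V ℝ)
  set ev : V → ℝ := hH.eigenvalues
  have hU : star U * U = 1 := Unitary.coe_star_mul_self hH.eigenvectorUnitary
  have hT : star U = U.transpose := by
    rw [Matrix.star_eq_conjTranspose, Matrix.conjTranspose_eq_transpose_of_trivial]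
  rw [hT] at hU
  have hA : normalizedLaplacian Γ = U * Matrix.diagonal ev * U.transpose := by
    conv_lhs => rw [hH.spectral_theorem]
    rw [Unitary.conjStarAlgAut_apply, ← hT]
    rfl
  have hG : normalizedGreen Γ = U * Matrix.diagonal (fun j => (ev j)⁻¹) * U.transpose := by
    ext x y
    rw [Matrix.mul_apply]
    simp only [Matrix.mul_diagonal, normalizedGreen, Matrix.of_apply, Matrix.transpose_apply]
    refine Finset.sum_congr rfl fun j _ => ?_
    have e1 : ∀ x, U x j = hH.eigenvectorBasis j x := fun x =>
      Matrix.IsHermitian.eigenvectorUnitary_apply hH x j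
    rw [e1, e1]
    split_ifs with h
    · rw [one_div]; ring
    · have : ev j = 0 := le_antisymm (not_lt.1 h) (hpos j)
      rw [this]; simp
  have key : ∀ a b : V → ℝ, (U * Matrix.diagonal a * U.transpose) *
      (U * Matrix.diagonal b * U.transpose)
        = U * Matrix.diagonal (fun j => a j * b j) * U.transpose := fun a b => by
    calc _ = U * Matrix.diagonal a * (U.transpose * U) * Matrix.diagonal b * U.transpose := by
          simp only [Matrix.mul_assoc]
      _ = _ := by rw [hU, mul_one, Matrix.mul_assoc U, Matrix.diagonal_mul_diagonal]
  have symm : ∀ a : V → ℝ, (U * Matrix.diagonal a * U.transpose).transpose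
      = U * Matrix.diagonal a * U.transpose := fun a => by
    simp [Matrix.transpose_mul, Matrix.mul_assoc]
  rw [hA, hG]
  constructor
  · rw [key, key]; congr; ext j; exact mul_inv_mul_cancel (ev j)
  · rw [key, key]; congr; ext j
    rcases eq_or_ne (ev j) 0 with h | h
    · simp [h]
    · field_simp
  · rw [key, symm]
  · rw [key, symm]


theorem normalizedLaplacian_eq_smul {d : ℕ} (hd : 0 < d) (hreg : ∀ x, Γ.degree x = d) :
    normalizedLaplacian Γ = (d : ℝ)⁻¹ • Γ.lapMatrix ℝ := by
  have hd' : (d : ℝ) ≠ 0 := by positivity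
  ext x y
  simp only [normalizedLaplacian, SimpleGraph.lapMatrix, SimpleGraph.degMatrix, Matrix.of_apply,
    Matrix.smul_apply, Matrix.sub_apply, Matrix.diagonal_apply, SimpleGraph.adjMatrix_apply, hreg,
    Real.sqrt_mul_self (Nat.cast_nonneg d), smul_eq_mul]
  by_cases h : x = y
  · subst h; simp [hd']
  · by_cases h' : Γ.Adj x y <;> simp [h, h', div_eq_mul_inv]

theorem discreteLaplacian_eq_smul {d : ℕ} (hd : 0 < d) (hreg : ∀ x, Γ.degree x = d) :
    discreteLaplacian Γ = (d : ℝ)⁻¹ • Γ.lapMatrix ℝ := by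
  rw [← normalizedLaplacian_eq_smul Γ hd hreg]
  ext x y
  simp only [normalizedLaplacian, discreteLaplacian, Matrix.of_apply, hreg,
    Real.sqrt_mul_self (Nat.cast_nonneg d)]

theorem normalizedGreen_eq_smul {d : ℕ} (hd : 0 < d) (hreg : ∀ x, Γ.degree x = d)
    {X : Matrix V V ℝ} (hX : IsPseudoInverse (Γ.lapMatrix ℝ) X) :
    normalizedGreen Γ = (d : ℝ) • X := by
  have hd' : (d : ℝ) ≠ 0 := by positivity
  have h1 := normalizedLaplacian_eq_smul Γ hd hreg
  have hp : (normalizedLaplacian Γ).PosSemidef := by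
    rw [h1]
    exact (SimpleGraph.posSemidef_lapMatrix ℝ Γ).smul (by positivity)
  have h2 := normalizedGreen_isPseudoInverse Γ fun j => hp.eigenvalues_nonneg j
  have h3 := hX.smul (inv_ne_zero hd')
  rw [← h1, inv_inv] at h3
  exact h2.unique h3

/-- The factor by which the Green's function of a `d`-regular graph differs from that of `L`. -/
def LaplacianKind.factor (d : ℕ) : LaplacianKind → ℕ
  | .combinatorial => 1
  | .normalized => d
  | .discrete => d

/-- With $D=d\cdot 1$, the normalized Green's function is $dX$. Multiplying by $D^{-1/2}$ on both
sides cancels $d$, while conjugation by $D^{1/2}$ changes nothing. -/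
theorem greenFunction_of_regular (κ : LaplacianKind) {d : ℕ} (hd : 0 < d)
    (hreg : ∀ x, Γ.degree x = d) {X : Matrix V V ℝ} (hX : IsPseudoInverse (Γ.lapMatrix ℝ) X) :
    greenFunction Γ κ = (κ.factor d : ℝ) • X ∧
      IsPseudoInverse (laplacian Γ κ) ((κ.factor d : ℝ) • X) := by
  have hd' : (d : ℝ) ≠ 0 := by positivity
  have hs : Real.sqrt d ≠ 0 := by positivity
  have hss : Real.sqrt d * Real.sqrt d = d := Real.mul_self_sqrt (Nat.cast_nonneg d)
  have hG := normalizedGreen_eq_smul Γ hd hreg hX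
  have h3 := hX.smul (inv_ne_zero hd')
  rw [inv_inv] at h3
  cases κ with
  | combinatorial =>
    refine ⟨?_, by simpa [LaplacianKind.factor, laplacian] using hX⟩
    ext x y
    simp [greenFunction, hG, hreg, hss, LaplacianKind.factor, hd']
  | normalized =>
    refine ⟨by simp [greenFunction, hG, LaplacianKind.factor], ?_⟩
    simpa only [laplacian, LaplacianKind.factor, normalizedLaplacian_eq_smul Γ hd hreg] using h3
  | discrete =>
    refine ⟨?_, by
      simpa only [laplacian, LaplacianKind.factor, discreteLaplacian_eq_smul Γ hd hreg] using h3⟩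
    ext x y
    simp [greenFunction, hG, hreg, LaplacianKind.factor, hs]

end Regular

/-! ### Functions on a cycle -/

/-- The distance `|y - x|` of two residues. -/
def cycDist {m : ℕ} (x y : Fin m) : ℕ := ((y : ℕ) - (x : ℕ)) + ((x : ℕ) - (y : ℕ))

theorem cycDist_lt {m : ℕ} (x y : Fin m) : cycDist x y < m := by
  unfold cycDist; omega

theorem cycDist_comm {m : ℕ} (x y : Fin m) : cycDist x y = cycDist y x := by
  unfold cycDist; omega

theorem cycDist_eq_zero {m : ℕ} {x y : Fin m} : cycDist x y = 0 ↔ x = y := by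
  unfold cycDist; rw [Fin.ext_iff]; omega

/-- The reflection symmetry makes `φ` insensitive to the wrap-around: stepping past either end
replaces a distance `j` by `m - j`. The bound `3 ≤ m` keeps the two neighbours distinct. -/
theorem sum_neighborFinset_cycleGraph {m : ℕ} (hm : 3 ≤ m) {φ : ℕ → ℝ}
    (hφ : ∀ j ≤ m, φ j = φ (m - j)) (x y : Fin m) :
    ∑ v ∈ (SimpleGraph.cycleGraph m).neighborFinset y, φ (cycDist x v) =
      if cycDist x y = 0 then 2 * φ 1 else φ (cycDist x y + 1) + φ (cycDist x y - 1) := by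
  obtain ⟨l, rfl⟩ : ∃ l, m = l + 3 := ⟨m - 3, by omega⟩
  have h1 : (1 : Fin (l + 3)).val = 1 := rfl
  have hx := x.isLt
  have hy := y.isLt
  have hs : (y - 1).val = if y.val = 0 then l + 2 else y.val - 1 := by
    rw [Fin.sub_def, h1]
    split_ifs with h
    · rw [h]; exact Nat.mod_eq_of_lt (by omega)
    · have : l + 3 - 1 + y.val = y.val - 1 + (l + 3) := by omega
      simp only [this, Nat.add_mod_right]
      exact Nat.mod_eq_of_lt (by omega)
  have ha : (y + 1).val = if y.val = l + 2 then 0 else y.val + 1 := by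
    rw [Fin.val_add, h1]
    split_ifs with h
    · rw [h]; simp
    · exact Nat.mod_eq_of_lt (by omega)
  rw [SimpleGraph.cycleGraph_neighborFinset, Finset.sum_pair]
  · have e : ∀ a b : ℕ, a = b ∨ a + b = l + 3 → φ a = φ b := fun a b h => by
      rcases h with h | h
      · rw [h]
      · rw [hφ a (by omega)]; congr 1; omega
    unfold cycDist
    rw [hs, ha]
    split_ifs with h h2 h3 h2 h3
    all_goals first
      | omega
      | (rw [two_mul]; congr 1 <;> exact e _ _ (by omega))
      | (rcases lt_or_ge x.val y.val with hlt | hlt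
         · rw [add_comm]; congr 1 <;> exact e _ _ (by omega)
         · congr 1 <;> exact e _ _ (by omega))
  · intro h
    have := congrArg Fin.val h
    rw [hs, ha] at this
    split_ifs at this <;> omega

/-- The vertices from `x` on have the distances `0, …, m - x - 1`; those before `x` have `1, …, x`,
which reflect to `m - x, …, m - 1`. -/
theorem sum_cycDist {m : ℕ} {φ : ℕ → ℝ} (hφ : ∀ j ≤ m, φ j = φ (m - j)) (x : Fin m) :
    ∑ y : Fin m, φ (cycDist x y) = ∑ d ∈ Finset.range m, φ d := by
  have hx := x.isLt
  have e : ∑ y : Fin m, φ (cycDist x y)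
      = ∑ y ∈ Finset.range m, φ ((y - (x : ℕ)) + ((x : ℕ) - y)) := by
    rw [Finset.sum_range]; rfl
  rw [e]
  obtain ⟨b, hb⟩ : ∃ b, m = x + b := ⟨m - x, by omega⟩
  rw [show Finset.range m = Finset.range (x + b) by rw [← hb], Finset.sum_range_add]
  rw [add_comm (x : ℕ) b, Finset.sum_range_add, add_comm]
  congr 1
  · exact Finset.sum_congr rfl fun i hi => by congr 1; omega
  · refine Finset.sum_congr rfl fun i hi => ?_
    rw [Finset.mem_range] at hi
    rw [hφ _ (by omega)]; congr 1; omega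

/-- A sum of cosines over a full period. -/
theorem sum_cos_eq_zero {m k : ℕ} (hk : 0 < k) (hkm : k < m) :
    ∑ d ∈ Finset.range m, Real.cos (2 * Real.pi * (k * d) / m) = 0 := by
  have hm : (0 : ℝ) < m := by exact_mod_cast hk.trans hkm
  set θ : ℝ := Real.pi * k / m with hθ
  have hs : Real.sin θ ≠ 0 := by
    refine (Real.sin_pos_of_pos_of_lt_pi (by positivity) ?_).ne'
    rw [hθ, div_lt_iff₀ hm]
    exact mul_lt_mul_of_pos_left (by exact_mod_cast hkm) Real.pi_pos
  -- Multiplication by `2 sin θ` makes the sum telescope; at `N = m` the angle `(2 N - 1) θ` is `-θ`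
  -- up to full turns.
  have key : ∀ N : ℕ, 2 * Real.sin θ * ∑ d ∈ Finset.range N, Real.cos (2 * Real.pi * (k * d) / m)
      = Real.sin ((2 * N - 1) * θ) + Real.sin θ := by
    intro N
    induction N with
    | zero => simp
    | succ N ih =>
      rw [Finset.sum_range_succ, mul_add, ih]
      have e1 : 2 * Real.pi * (k * N) / m = 2 * N * θ := by rw [hθ]; ring
      have e2 : (2 * ((N + 1 : ℕ) : ℝ) - 1) * θ = 2 * N * θ + θ := by push_cast; ring
      have e3 : (2 * (N : ℝ) - 1) * θ = 2 * N * θ - θ := by ring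
      rw [e1, e2, e3, Real.sin_add, Real.sin_sub]
      ring
  have h := key m
  have e : (2 * (m : ℝ) - 1) * θ = k * (2 * Real.pi) - θ := by
    rw [hθ]; field_simp
  rw [e, Real.sin_nat_mul_two_pi_sub, neg_add_cancel] at h
  simpa [hs] using h

theorem cos_symm {m : ℕ} (hm : 0 < m) (k : ℕ) {j : ℕ} (hj : j ≤ m) :
    Real.cos (2 * Real.pi * (k * j) / m) = Real.cos (2 * Real.pi * (k * ((m - j : ℕ) : ℝ)) / m) := by
  have hm' : (m : ℝ) ≠ 0 := by positivity
  have : 2 * Real.pi * (k * ((m - j : ℕ) : ℝ)) / m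
      = k * (2 * Real.pi) - 2 * Real.pi * (k * j) / m := by
    rw [Nat.cast_sub hj]; field_simp
  rw [this, Real.cos_nat_mul_two_pi_sub]

theorem sum_neighbor_cos {m : ℕ} (hm : 3 ≤ m) (k : ℕ) (x y : Fin m) :
    ∑ v ∈ (SimpleGraph.cycleGraph m).neighborFinset y,
        Real.cos (2 * Real.pi * (k * (cycDist x v : ℝ)) / m) =
      2 * Real.cos (2 * Real.pi * k / m) * Real.cos (2 * Real.pi * (k * (cycDist x y : ℝ)) / m) := by
  rw [sum_neighborFinset_cycleGraph (φ := fun d => Real.cos (2 * Real.pi * (k * (d : ℝ)) / m)) hm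
    (fun j hj => cos_symm (by omega) k hj)]
  split_ifs with h
  · simp [h]
  · have h1 : ((cycDist x y - 1 : ℕ) : ℝ) = cycDist x y - 1 := by
      rw [Nat.cast_sub (by omega)]; simp
    rw [h1]
    push_cast
    have e1 : 2 * Real.pi * (k * ((cycDist x y : ℝ) + 1)) / m
      = 2 * Real.pi * (k * (cycDist x y : ℝ)) / m + 2 * Real.pi * k / m := by ring
    have e2 : 2 * Real.pi * (k * ((cycDist x y : ℝ) - 1)) / m
      = 2 * Real.pi * (k * (cycDist x y : ℝ)) / m - 2 * Real.pi * k / m := by ring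
    rw [e1, e2, Real.cos_add, Real.cos_sub]
    ring

/-- The first row of the Green's function of the cycle of length `m`. -/
noncomputable def cycleGreen (m d : ℕ) : ℝ :=
  ((m : ℝ) * m - 1) / (12 * m) - (d : ℝ) * (m - d) / (2 * m)

/-- The first row of the inverse of `L + μ` on the cycle of length `m`, where `r + 1 / r = 2 + μ`. -/
noncomputable def cycleResolvent (m : ℕ) (r : ℝ) (d : ℕ) : ℝ :=
  (r ^ d + r ^ (m - d)) / ((1 - r ^ m) * (1 / r - r))

theorem cycleGreen_symm {m j : ℕ} (hj : j ≤ m) : cycleGreen m j = cycleGreen m (m - j) := by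
  unfold cycleGreen
  rw [Nat.cast_sub hj]; ring

theorem cycleResolvent_symm {m j : ℕ} (r : ℝ) (hj : j ≤ m) :
    cycleResolvent m r j = cycleResolvent m r (m - j) := by
  unfold cycleResolvent
  rw [Nat.sub_sub_self hj, add_comm]

/-- The quadratic has constant second difference `1 / m`, and its kink at distance `0` supplies the
delta. The additive constant plays no role here; `sum_cycleGreen` fixes it. -/
theorem sum_neighbor_cycleGreen {m : ℕ} (hm : 3 ≤ m) (x y : Fin m) :
    ∑ v ∈ (SimpleGraph.cycleGraph m).neighborFinset y, cycleGreen m (cycDist x v) =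
      2 * cycleGreen m (cycDist x y) - (if x = y then 1 else 0) + 1 / m := by
  have hm' : (m : ℝ) ≠ 0 := by positivity
  rw [sum_neighborFinset_cycleGraph (φ := cycleGreen m) hm (fun j hj => cycleGreen_symm hj)]
  simp only [cycDist_eq_zero]
  split_ifs with h
  · rw [cycDist_eq_zero.2 h]
    unfold cycleGreen
    field_simp
    push_cast
    ring
  · have h1 : ((cycDist x y - 1 : ℕ) : ℝ) = cycDist x y - 1 := by
      rw [Nat.cast_sub (Nat.one_le_iff_ne_zero.2 (mt cycDist_eq_zero.1 h))]; simp
    unfold cycleGreen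
    rw [h1]
    field_simp
    push_cast
    ring

theorem sum_cycleGreen {m : ℕ} (hm : 0 < m) : ∑ d ∈ Finset.range m, cycleGreen m d = 0 := by
  have hm' : (m : ℝ) ≠ 0 := by positivity
  have key : ∀ (a : ℝ) (N : ℕ), ∑ d ∈ Finset.range N, ((d : ℝ) * (a - d))
      = (N - 1) * N * (3 * a - 2 * N + 1) / 6 := by
    intro a N
    induction N with
    | zero => simp
    | succ N ih => rw [Finset.sum_range_succ, ih]; push_cast; ring
  unfold cycleGreen
  rw [Finset.sum_sub_distrib, ← Finset.sum_div _ _ (2 * (m : ℝ)), key, Finset.sum_const, Finset.card_range,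
    nsmul_eq_mul]
  field_simp
  ring

/-- Both $r^d$ and $r^{-d}$ solve the homogeneous recurrence, and $r^d+r^{m-d}$ is their
reflection-symmetric combination. Its defect at $d=0$ is $-(1-r^m)(1/r-r)$, which explains the
denominator. -/
theorem sum_neighbor_cycleResolvent {m : ℕ} (hm : 3 ≤ m) {r : ℝ} (hr : 0 < r) (hr1 : r < 1)
    (x y : Fin m) :
    ∑ v ∈ (SimpleGraph.cycleGraph m).neighborFinset y, cycleResolvent m r (cycDist x v) =
      (r + 1 / r) * cycleResolvent m r (cycDist x y) - (if x = y then 1 else 0) := by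
  have h0 : (1 - r ^ m) * (1 / r - r) ≠ 0 := by
    refine mul_ne_zero ?_ ?_
    · exact (sub_pos.2 (pow_lt_one₀ hr.le hr1 (by omega))).ne'
    · have : 1 < 1 / r := by rwa [lt_div_iff₀ hr, one_mul]
      exact (sub_pos.2 (hr1.trans this)).ne'
  rw [sum_neighborFinset_cycleGraph (φ := cycleResolvent m r) hm (fun j hj => cycleResolvent_symm r hj)]
  simp only [cycDist_eq_zero]
  have hlt := cycDist_lt x y
  split_ifs with h
  · rw [cycDist_eq_zero.2 h]
    unfold cycleResolvent
    obtain ⟨l, rfl⟩ : ∃ l, m = l + 1 := ⟨m - 1, by omega⟩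
    rw [eq_sub_iff_add_eq]
    rw [← mul_div_assoc, ← mul_div_assoc, div_add' _ _ _ h0]
    congr 1
    simp only [Nat.sub_zero, Nat.add_sub_cancel]
    field_simp
    ring
  · have hpos : cycDist x y ≠ 0 := mt cycDist_eq_zero.1 h
    obtain ⟨a, ha⟩ : ∃ a, cycDist x y = a + 1 := ⟨cycDist x y - 1, by omega⟩
    obtain ⟨b, hb⟩ : ∃ b, m = a + 1 + (b + 1) := ⟨m - (a + 2), by omega⟩
    unfold cycleResolvent
    rw [ha, sub_zero, ← add_div, ← mul_div_assoc]
    congr 1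
    have e1 : m - (a + 1 + 1) = b := by omega
    have e2 : m - (a + 1) = b + 1 := by omega
    have e3 : m - (a + 1 - 1) = b + 2 := by omega
    rw [e1, e2, e3, Nat.add_sub_cancel]
    field_simp
    ring

/-- The smaller root of `r + 1 / r = 2 + μ`. -/
noncomputable def smallRoot (μ : ℝ) : ℝ := (2 + μ - Real.sqrt ((2 + μ) * (2 + μ) - 4)) / 2

theorem smallRoot_spec {μ : ℝ} (hμ : 0 < μ) :
    0 < smallRoot μ ∧ smallRoot μ < 1 ∧ smallRoot μ + 1 / smallRoot μ = 2 + μ := by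
  unfold smallRoot
  set q := Real.sqrt ((2 + μ) * (2 + μ) - 4) with hq
  have hnn : 0 ≤ (2 + μ) * (2 + μ) - 4 := by nlinarith
  have hqq : q * q = (2 + μ) * (2 + μ) - 4 := Real.mul_self_sqrt hnn
  have hq0 : 0 ≤ q := Real.sqrt_nonneg _
  have h1 : q < 2 + μ := by nlinarith
  -- This is the bound `smallRoot μ < 1`; it holds because `q * q = μ * μ + 4 * μ`.
  have h2 : μ < q := by nlinarith
  refine ⟨by linarith, by linarith, ?_⟩
  have : 2 + μ - q ≠ 0 := by linarith
  field_simp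
  nlinarith

/-! ### The Green's function of a torus -/

section Torus

variable {t : ℕ} (m : Fin t → ℕ)

/-- A neighbour of `y` is the same as a direction together with a neighbour of `y s` in that cycle;
only the factor in this direction changes. -/
theorem sum_neighborFinset_torus (f : ∀ s, Fin (m s) → ℝ) (y : ∀ s, Fin (m s)) :
    ∑ y' ∈ (torus m).neighborFinset y, ∏ r, f r (y' r) =
      ∑ s, (∑ v ∈ (SimpleGraph.cycleGraph (m s)).neighborFinset (y s), f s v)
        * ∏ r ∈ Finset.univ.erase s, f r (y r) := by
  simp only [Finset.sum_mul]
  rw [Finset.sum_sigma']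
  symm
  refine Finset.sum_bij (fun p _ => Function.update y p.1 p.2) ?_ ?_ ?_ ?_
  · rintro ⟨s, v⟩ h
    simp only [Finset.mem_sigma, SimpleGraph.mem_neighborFinset] at h ⊢
    refine ⟨s, by simpa using h.2, fun r hr => ?_⟩
    simp [Function.update_of_ne hr]
  · rintro ⟨s, v⟩ h ⟨s', v'⟩ h' heq
    simp only [Finset.mem_sigma, SimpleGraph.mem_neighborFinset] at h h' heq
    by_cases hs : s = s'
    · subst hs
      have := congrFun heq s
      simp only [Function.update_self] at this
      rw [this]
    · have := congrFun heq s
      rw [Function.update_self, Function.update_of_ne hs] at this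
      exact absurd this.symm h.2.ne
  · intro y' h
    rw [SimpleGraph.mem_neighborFinset] at h
    obtain ⟨s, h1, h2⟩ := h
    refine ⟨⟨s, y' s⟩, by simpa using h1, ?_⟩
    funext r
    by_cases hr : r = s
    · subst hr; simp
    · simp [Function.update_of_ne hr, h2 r hr]
  · rintro ⟨s, v⟩ _
    rw [← Finset.mul_prod_erase Finset.univ _ (Finset.mem_univ s)]
    congr 1
    · simp
    · refine Finset.prod_congr rfl fun r hr => ?_
      rw [Function.update_of_ne (Finset.ne_of_mem_erase hr)]

theorem torus_degree (hm : ∀ s, 3 ≤ m s) (y : ∀ s, Fin (m s)) : (torus m).degree y = 2 * t := by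
  -- With all factors equal to `1`, the sum over the neighbours counts them.
  have h := sum_neighborFinset_torus m (fun _ _ => 1) y
  have h' : ∀ s, ((SimpleGraph.cycleGraph (m s)).degree (y s) : ℝ) = 2 := fun s => by
    have := sum_neighborFinset_cycleGraph (φ := fun _ => 1) (hm s) (fun _ _ => rfl) (y s) (y s)
    simp at this
    rw [this]
    norm_num
  simp [h'] at h
  rw [mul_comm]
  exact_mod_cast h

/-- The lengths of the cycles, with the cycle in direction `J` contracted. -/
def reducedRadix (J : Fin t) (s : Fin t) : ℕ := if s = J then 1 else m s

theorem mul_prod_reducedRadix (J : Fin t) : m J * ∏ s, reducedRadix m J s = ∏ s, m s := by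
  rw [← Finset.mul_prod_erase Finset.univ _ (Finset.mem_univ J),
    ← Finset.mul_prod_erase Finset.univ m (Finset.mem_univ J)]
  simp only [reducedRadix, if_true, one_mul]
  congr 1
  exact Finset.prod_congr rfl fun s hs => if_neg (Finset.ne_of_mem_erase hs)

/-- The cosine of the mode `k` in one coordinate direction. -/
noncomputable def mode (l k d : ℕ) : ℝ := Real.cos (2 * Real.pi * ((k : ℝ) * d) / l)

/-- The eigenvalue of the combinatorial Laplacian that belongs to the modes `k`. -/
noncomputable def modeEigenvalue (k : Fin t → ℕ) : ℝ :=
  ∑ s, (2 - 2 * Real.cos (2 * Real.pi * k s / m s))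

/-- The dependence of the mode `k` of the Green's function on the coordinate in direction `J`. -/
noncomputable def axialGreen (J : Fin t) (k : Fin t → ℕ) (d : ℕ) : ℝ :=
  if k = 0 then cycleGreen (m J) d else cycleResolvent (m J) (smallRoot (modeEigenvalue m k)) d

/-- The frequencies in the directions other than `J`. -/
def modes (J : Fin t) : Finset (Fin t → ℕ) :=
  Fintype.piFinset fun s => Finset.range (reducedRadix m J s)

/-- The first row of the Green's function of the torus. -/
noncomputable def torusRow (J : Fin t) (d : Fin t → ℕ) : ℝ :=
  (∑ k ∈ modes m J, (∏ s, mode (m s) (k s) (d s)) * axialGreen m J k (d J))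
    / ∏ s, (reducedRadix m J s : ℝ)

variable {m}

theorem modes_apply_self {J : Fin t} {k : Fin t → ℕ} (hk : k ∈ modes m J) : k J = 0 := by
  have := Fintype.mem_piFinset.1 hk J
  simpa [reducedRadix] using this

theorem modes_lt (hm : ∀ s, 3 ≤ m s) {J : Fin t} {k : Fin t → ℕ} (hk : k ∈ modes m J) (s : Fin t) :
    k s < m s := by
  have := Finset.mem_range.1 (Fintype.mem_piFinset.1 hk s)
  have := hm s
  unfold reducedRadix at *
  split_ifs at * <;> omega

theorem zero_mem_modes (hm : ∀ s, 3 ≤ m s) (J : Fin t) : (0 : Fin t → ℕ) ∈ modes m J := by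
  refine Fintype.mem_piFinset.2 fun s => Finset.mem_range.2 ?_
  have := hm s
  unfold reducedRadix
  split_ifs <;> simp; omega

theorem mode_zero (l d : ℕ) : mode l 0 d = 1 := by simp [mode]

theorem sum_neighbor_mode {l : ℕ} (hl : 3 ≤ l) (k : ℕ) (x y : Fin l) :
    ∑ v ∈ (SimpleGraph.cycleGraph l).neighborFinset y, mode l k (cycDist x v) =
      2 * Real.cos (2 * Real.pi * k / l) * mode l k (cycDist x y) :=
  sum_neighbor_cos hl k x y

/-- A nonzero frequency lies strictly between `0` and the cycle length, so its cosine is not `1`: by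
the half-angle formula that would require the sine of an angle inside $(0,\pi)$ to vanish. -/
theorem modeEigenvalue_pos (hm : ∀ s, 3 ≤ m s) {J : Fin t} {k : Fin t → ℕ} (hk : k ∈ modes m J)
    (h0 : k ≠ 0) : 0 < modeEigenvalue m k := by
  obtain ⟨s, hs⟩ := Function.ne_iff.1 h0
  refine Finset.sum_pos' (fun s _ => ?_) ⟨s, Finset.mem_univ s, ?_⟩
  · linarith [Real.cos_le_one (2 * Real.pi * k s / m s)]
  · have hlt := modes_lt hm hk s
    have hpos : 0 < k s := Nat.pos_of_ne_zero hs
    have hm0 : (0 : ℝ) < m s := by exact_mod_cast hpos.trans hlt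
    have hne : Real.cos (2 * Real.pi * k s / m s) ≠ 1 := by
      intro h
      have h2 : 2 * Real.pi * k s / m s = 2 * (Real.pi * k s / m s) := by ring
      rw [h2, Real.cos_two_mul] at h
      have h3 : 0 < Real.sin (Real.pi * k s / m s) := by
        refine Real.sin_pos_of_pos_of_lt_pi (by positivity) ?_
        rw [div_lt_iff₀ hm0]
        exact mul_lt_mul_of_pos_left (by exact_mod_cast hlt) Real.pi_pos
      nlinarith [Real.sin_sq_add_cos_sq (Real.pi * k s / m s)]
    have := lt_of_le_of_ne (Real.cos_le_one _) hne
    linarith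

/-- This treats both closed forms uniformly: only the zero mode, where $L_C$ is singular, leaves the
correction `1 / m J`. -/
theorem sum_neighbor_axialGreen (hm : ∀ s, 3 ≤ m s) {J : Fin t} {k : Fin t → ℕ}
    (hk : k ∈ modes m J) (x y : Fin (m J)) :
    ∑ v ∈ (SimpleGraph.cycleGraph (m J)).neighborFinset y, axialGreen m J k (cycDist x v) =
      (2 + modeEigenvalue m k) * axialGreen m J k (cycDist x y) - (if x = y then 1 else 0)
        + (if k = 0 then 1 / (m J : ℝ) else 0) := by
  unfold axialGreen
  split_ifs with h0 h h
  · have := sum_neighbor_cycleGreen (hm J) x y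
    rw [if_pos h] at this
    rw [this, h0]
    simp [modeEigenvalue]
  · have := sum_neighbor_cycleGreen (hm J) x y
    rw [if_neg h] at this
    rw [this, h0]
    simp [modeEigenvalue]
  all_goals
    obtain ⟨h1, h2, h3⟩ := smallRoot_spec (modeEigenvalue_pos hm hk h0)
    have := sum_neighbor_cycleResolvent (hm J) h1 h2 x y
    first | rw [if_pos h] at this | rw [if_neg h] at this
    rw [this, h3, add_zero]

/-- One mode of the Green's function, as a product of functions of one coordinate. -/
noncomputable def modeFactor (m : Fin t → ℕ) (J : Fin t) (k : Fin t → ℕ) (s : Fin t) (d : ℕ) : ℝ :=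
  if s = J then axialGreen m J k d else mode (m s) (k s) d

theorem prod_modeFactor {J : Fin t} {k : Fin t → ℕ} (hk : k ∈ modes m J) (d : Fin t → ℕ) :
    ∏ s, modeFactor m J k s (d s) = (∏ s, mode (m s) (k s) (d s)) * axialGreen m J k (d J) := by
  rw [← Finset.mul_prod_erase Finset.univ _ (Finset.mem_univ J),
    ← Finset.mul_prod_erase Finset.univ (fun s => mode (m s) (k s) (d s)) (Finset.mem_univ J),
    modes_apply_self hk, mode_zero, one_mul, mul_comm]
  congr 1
  · exact Finset.prod_congr rfl fun s hs => if_neg (Finset.ne_of_mem_erase hs)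
  · simp [modeFactor]

/-- Direction `s ≠ J` multiplies the product by $2\cos(2\pi k_s/m_s)$. Direction `J` multiplies it
by $2+\mu_k$ and leaves the delta terms. Since $k_J=0$, the part $2$ is also of the cosine form, and
$\mu_k=2t-\sum_s 2\cos(2\pi k_s/m_s)$ cancels everything except the delta terms. -/
theorem laplacian_modeFactor (hm : ∀ s, 3 ≤ m s) {J : Fin t} {k : Fin t → ℕ}
    (hk : k ∈ modes m J) (x y : ∀ s, Fin (m s)) :
    2 * t * (∏ s, modeFactor m J k s (cycDist (x s) (y s)))
      - ∑ y' ∈ (torus m).neighborFinset y, ∏ s, modeFactor m J k s (cycDist (x s) (y' s))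
    = ((if x J = y J then 1 else 0) - (if k = 0 then 1 / (m J : ℝ) else 0))
        * ∏ s, mode (m s) (k s) (cycDist (x s) (y s)) := by
  rw [sum_neighborFinset_torus m (fun s v => modeFactor m J k s (cycDist (x s) v))]
  set P := ∏ s, modeFactor m J k s (cycDist (x s) (y s)) with hP
  set Q := ∏ s, mode (m s) (k s) (cycDist (x s) (y s)) with hQ
  set a : ℝ := (if x J = y J then 1 else 0) - (if k = 0 then 1 / (m J : ℝ) else 0) with ha
  have hterm : ∀ s, (∑ v ∈ (SimpleGraph.cycleGraph (m s)).neighborFinset (y s),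
      modeFactor m J k s (cycDist (x s) v))
        * ∏ r ∈ Finset.univ.erase s, modeFactor m J k r (cycDist (x r) (y r))
      = 2 * Real.cos (2 * Real.pi * k s / m s) * P
        + if s = J then modeEigenvalue m k * P - a * Q else 0 := by
    intro s
    have hPs : P = modeFactor m J k s (cycDist (x s) (y s))
        * ∏ r ∈ Finset.univ.erase s, modeFactor m J k r (cycDist (x r) (y r)) :=
      (Finset.mul_prod_erase Finset.univ _ (Finset.mem_univ s)).symm
    split_ifs with h
    · subst h
      have hQ' : Q = ∏ r ∈ Finset.univ.erase s, modeFactor m s k r (cycDist (x r) (y r)) := by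
        rw [hQ, ← Finset.mul_prod_erase Finset.univ _ (Finset.mem_univ s),
          modes_apply_self hk, mode_zero, one_mul]
        exact Finset.prod_congr rfl fun r hr => (if_neg (Finset.ne_of_mem_erase hr)).symm
      rw [hPs, ← hQ', modes_apply_self hk]
      simp only [modeFactor, if_true]
      rw [sum_neighbor_axialGreen hm hk, ha]
      simp
      ring
    · rw [hPs]
      simp only [modeFactor, h, if_false]
      rw [sum_neighbor_mode (hm s)]
      ring
  rw [Finset.sum_congr rfl fun s _ => hterm s, Finset.sum_add_distrib, ← Finset.sum_mul,
    Finset.sum_ite_eq' Finset.univ J, if_pos (Finset.mem_univ J)]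
  have : modeEigenvalue m k = 2 * t - ∑ s, 2 * Real.cos (2 * Real.pi * k s / m s) := by
    rw [modeEigenvalue, Finset.sum_sub_distrib]
    simp [mul_comm]
  rw [this]
  ring

theorem sum_mode {l : ℕ} {d : ℕ} (hd : d < l) :
    ∑ k ∈ Finset.range l, mode l k d = if d = 0 then (l : ℝ) else 0 := by
  split_ifs with h
  · simp [mode, h]
  · rw [← sum_cos_eq_zero (Nat.pos_of_ne_zero h) hd]
    exact Finset.sum_congr rfl fun k _ => by rw [mode, mul_comm (k : ℝ)]

/-- Orthogonality of the modes: the sum factors over the directions. Direction `J` is not summed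
over, so agreement there has to be assumed. -/
theorem sum_prod_mode (J : Fin t) (x y : ∀ s, Fin (m s)) (h : x J = y J) :
    ∑ k ∈ modes m J, ∏ s, mode (m s) (k s) (cycDist (x s) (y s))
      = if x = y then ∏ s, (reducedRadix m J s : ℝ) else 0 := by
  rw [modes, ← Finset.prod_univ_sum _ fun s k => mode (m s) k (cycDist (x s) (y s))]
  have e : ∀ s, ∑ k ∈ Finset.range (reducedRadix m J s), mode (m s) k (cycDist (x s) (y s))
      = if x s = y s then (reducedRadix m J s : ℝ) else 0 := by
    intro s
    unfold reducedRadix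
    by_cases hs : s = J
    · subst hs; simp [h, mode_zero]
    · simp only [hs, if_false]
      rw [sum_mode (cycDist_lt _ _)]
      simp only [cycDist_eq_zero]
  rw [Finset.prod_congr rfl fun s _ => e s]
  split_ifs with hxy
  · subst hxy; simp
  · obtain ⟨s, hs⟩ := Function.ne_iff.1 hxy
    exact Finset.prod_eq_zero (Finset.mem_univ s) (if_neg hs)

/-- The matrix with the first row `torusRow`. -/
noncomputable def torusGreen (m : Fin t → ℕ) (J : Fin t) :
    Matrix (∀ s, Fin (m s)) (∀ s, Fin (m s)) ℝ :=
  Matrix.of fun x y => torusRow m J fun s => cycDist (x s) (y s)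

theorem torusGreen_apply (J : Fin t) (x y : ∀ s, Fin (m s)) :
    torusGreen m J x y = (∑ k ∈ modes m J, ∏ s, modeFactor m J k s (cycDist (x s) (y s)))
      / ∏ s, (reducedRadix m J s : ℝ) := by
  rw [torusGreen, Matrix.of_apply, torusRow]
  congr 1
  exact Finset.sum_congr rfl fun k hk =>
    (prod_modeFactor hk fun s => cycDist (x s) (y s)).symm

theorem torusGreen_symm (J : Fin t) : (torusGreen m J).transpose = torusGreen m J := by
  ext x y
  simp only [torusGreen, Matrix.transpose_apply, Matrix.of_apply, fun s => cycDist_comm (y s) (x s)]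

theorem prod_reducedRadix_ne_zero (hm : ∀ s, 3 ≤ m s) (J : Fin t) :
    ∏ s, (reducedRadix m J s : ℝ) ≠ 0 := by
  refine Finset.prod_ne_zero_iff.2 fun s _ => ?_
  have := hm s
  unfold reducedRadix
  split_ifs
  · simp
  · exact_mod_cast (by omega : m s ≠ 0)

/-- Summed over the modes, the delta in direction `J` becomes the identity by orthogonality. The
correction comes from the zero mode alone and equals $1/(m_J\prod_{s\ne J}m_s)=1/n$. -/
theorem torusGreen_mul_lapMatrix (hm : ∀ s, 3 ≤ m s) (J : Fin t) :
    torusGreen m J * (torus m).lapMatrix ℝ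
      = 1 - Matrix.of fun _ _ => 1 / ∏ s, (m s : ℝ) := by
  have hq := prod_reducedRadix_ne_zero hm J
  have hmJ : (m J : ℝ) ≠ 0 := by exact_mod_cast (by have := hm J; omega : m J ≠ 0)
  have hn : (m J : ℝ) * ∏ s, (reducedRadix m J s : ℝ) = ∏ s, (m s : ℝ) := by
    exact_mod_cast mul_prod_reducedRadix m J
  have hL : ∀ x y, (torusGreen m J * (torus m).lapMatrix ℝ) x y
      = 2 * t * torusGreen m J x y
        - ∑ y' ∈ (torus m).neighborFinset y, torusGreen m J x y' := by
    intro x y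
    have hsym : (torus m).lapMatrix ℝ = ((torus m).lapMatrix ℝ).transpose :=
      ((torus m).isSymm_lapMatrix (R := ℝ)).symm
    rw [hsym, Matrix.mul_apply]
    simp only [Matrix.transpose_apply]
    have := SimpleGraph.lapMatrix_mulVec_apply (R := ℝ) (torus m) y (fun z => torusGreen m J x z)
    rw [torus_degree m hm y] at this
    push_cast at this
    rw [← this, Matrix.mulVec, dotProduct]
    exact Finset.sum_congr rfl fun _ _ => mul_comm _ _
  ext x y
  rw [hL]
  simp only [torusGreen_apply]
  rw [← Finset.sum_div, Finset.sum_comm, ← mul_div_assoc, ← sub_div, Finset.mul_sum,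
    ← Finset.sum_sub_distrib, Finset.sum_congr rfl fun k hk => laplacian_modeFactor hm hk x y]
  simp only [sub_mul, Finset.sum_sub_distrib]
  rw [← Finset.mul_sum]
  simp only [ite_mul, zero_mul]
  rw [Finset.sum_ite_eq' (modes m J) 0, if_pos (zero_mem_modes hm J)]
  simp only [Pi.zero_apply, mode_zero, Finset.prod_const_one, mul_one, Matrix.sub_apply,
    Matrix.of_apply, Matrix.one_apply, one_mul]
  rw [sub_div, ← hn]
  congr 1
  · by_cases h : x J = y J
    · rw [if_pos h, sum_prod_mode J x y h]
      split_ifs <;> simp [hq]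
    · rw [if_neg h, if_neg (fun hxy => h (by rw [hxy])), zero_div]
  · field_simp

/-- The row sum of each mode factors over the directions. Some factor vanishes: the one in direction
`J` for the zero mode, a full cosine sum otherwise. -/
theorem sum_torusGreen (hm : ∀ s, 3 ≤ m s) (J : Fin t) (x : ∀ s, Fin (m s)) :
    ∑ y, torusGreen m J x y = 0 := by
  simp only [torusGreen_apply]
  rw [← Finset.sum_div, Finset.sum_comm, Finset.sum_eq_zero, zero_div]
  intro k hk
  have e := (Finset.prod_univ_sum (fun s => (Finset.univ : Finset (Fin (m s))))
    (fun s v => modeFactor m J k s (cycDist (x s) v))).symm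
  rw [Fintype.piFinset_univ] at e
  rw [e]
  by_cases h0 : k = 0
  · refine Finset.prod_eq_zero (Finset.mem_univ J) ?_
    simp only [modeFactor, if_true, axialGreen, h0]
    rw [sum_cycDist (φ := cycleGreen (m J)) (fun j hj => cycleGreen_symm hj),
      sum_cycleGreen (by have := hm J; omega)]
  · obtain ⟨s, hs⟩ := Function.ne_iff.1 h0
    have hsJ : s ≠ J := fun h => hs (by rw [h]; exact modes_apply_self hk)
    refine Finset.prod_eq_zero (Finset.mem_univ s) ?_
    simp only [modeFactor, hsJ, if_false]
    rw [sum_cycDist (φ := mode (m s) (k s))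
      (fun j hj => cos_symm (by have := hm s; omega) (k s) hj)]
    exact sum_cos_eq_zero (Nat.pos_of_ne_zero hs) (modes_lt hm hk s)

theorem torusGreen_isPseudoInverse (hm : ∀ s, 3 ≤ m s) (J : Fin t) :
    IsPseudoInverse ((torus m).lapMatrix ℝ) (torusGreen m J) := by
  have hL : ((torus m).lapMatrix ℝ).transpose = (torus m).lapMatrix ℝ :=
    (torus m).isSymm_lapMatrix (R := ℝ)
  have hLQ : ∀ c : ℝ, (torus m).lapMatrix ℝ * (Matrix.of fun _ _ => c) = 0 := by
    intro c
    ext x y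
    have h := congrFun ((torus m).lapMatrix_mulVec_const_eq_zero (R := ℝ)) x
    simp only [Matrix.mulVec, dotProduct, mul_one, Pi.zero_apply] at h
    simp only [Matrix.mul_apply, Matrix.of_apply, ← Finset.sum_mul, h, zero_mul, Matrix.zero_apply]
  refine IsPseudoInverse.of_mul_eq (Q := Matrix.of fun _ _ => 1 / ∏ s, (m s : ℝ)) hL
    (torusGreen_symm J) rfl ?_ ?_ ?_
  · rw [← hL, ← Matrix.transpose_transpose (Matrix.of fun _ _ => 1 / ∏ s, (m s : ℝ)),
      ← Matrix.transpose_mul]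
    exact (congrArg Matrix.transpose (hLQ _)).trans Matrix.transpose_zero
  · ext x y
    simp only [Matrix.mul_apply, Matrix.of_apply, ← Finset.sum_mul, sum_torusGreen hm, zero_mul,
      Matrix.zero_apply]
  · have h := congrArg Matrix.transpose (torusGreen_mul_lapMatrix hm J)
    rw [Matrix.transpose_mul, torusGreen_symm, hL, Matrix.transpose_sub, Matrix.transpose_one] at h
    exact h

end Torus

/-! ### Running programs with a time bound -/

namespace RealRAM

/-- The program `p` leads from `σ` to `σ'` in at most `B` steps. -/
def Steps (w : ℕ) (p : Program) (σ σ' : State) (B : ℕ) : Prop :=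
  ∃ k ≤ B, Exec w p σ σ' k

section Steps

variable {w : ℕ} {p q : Program} {σ σ' σ'' : State} {A B : ℕ}

theorem Steps.mono (h : Steps w p σ σ' A) (hAB : A ≤ B) : Steps w p σ σ' B :=
  let ⟨k, hk, h⟩ := h
  ⟨k, hk.trans hAB, h⟩

theorem Steps.seq (h : Steps w p σ σ' A) (h' : Steps w q σ' σ'' B) :
    Steps w (.seq p q) σ σ'' (A + B) :=
  let ⟨_, hk, h⟩ := h
  let ⟨_, hk', h'⟩ := h'
  ⟨_, add_le_add hk hk', .seq h h'⟩

theorem Steps.ifWord_true {a : WordExpr} (ha : a.eval w σ ≠ 0) (h : Steps w p σ σ' A) :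
    Steps w (.ifWord a p q) σ σ' (a.cost + 1 + A) :=
  let ⟨_, hk, h⟩ := h
  ⟨_, Nat.add_le_add_left hk _, .ifWord_true ha h⟩

theorem Steps.ifWord_false {a : WordExpr} (ha : a.eval w σ = 0) (h : Steps w q σ σ' A) :
    Steps w (.ifWord a p q) σ σ' (a.cost + 1 + A) :=
  let ⟨_, hk, h⟩ := h
  ⟨_, Nat.add_le_add_left hk _, .ifWord_false ha h⟩

/-- A loop with the invariant `Inv` that is executed `N` times. -/
theorem Steps.while {a : WordExpr} (Inv : ℕ → State → Prop) {N : ℕ}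
    (hcond : ∀ j ≤ N, ∀ σ, Inv j σ → (a.eval w σ ≠ 0 ↔ j < N))
    (hbody : ∀ j < N, ∀ σ, Inv j σ → ∃ σ', Steps w p σ σ' B ∧ Inv (j + 1) σ') (h0 : Inv 0 σ) :
    ∃ σ', Steps w (.while a p) σ σ' (N * (B + a.cost + 1) + (a.cost + 1)) ∧ Inv N σ' := by
  suffices H : ∀ i j σ, j + i = N → Inv j σ →
      ∃ σ', Steps w (.while a p) σ σ' (i * (B + a.cost + 1) + (a.cost + 1)) ∧ Inv N σ' from
    H N 0 σ (Nat.zero_add N) h0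
  intro i
  induction i with
  | zero =>
    intro j σ hj hI
    obtain rfl : j = N := hj
    have : a.eval w σ = 0 := by
      by_contra h
      exact lt_irrefl _ ((hcond j le_rfl σ hI).1 h)
    exact ⟨σ, ⟨_, by omega, .while_false this⟩, hI⟩
  | succ i ih =>
    intro j σ hj hI
    have hjN : j < N := by omega
    obtain ⟨σ₁, ⟨k, hk, h1⟩, hI1⟩ := hbody j hjN σ hI
    obtain ⟨σ₂, ⟨l, hl, h2⟩, hI2⟩ := ih (j + 1) σ₁ (by omega) hI1
    refine ⟨σ₂, ⟨_, ?_, .while_true ((hcond j hjN.le σ hI).2 hjN) h1 h2⟩, hI2⟩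
    rw [add_mul, one_mul]
    omega

/-- A loop that runs through the states `f 0, …, f N`. -/
theorem Steps.while_of_fun {a : WordExpr} (f : ℕ → State) {N : ℕ}
    (hcond : ∀ j ≤ N, (a.eval w (f j) ≠ 0 ↔ j < N))
    (hbody : ∀ j < N, Steps w p (f j) (f (j + 1)) B) :
    Steps w (.while a p) (f 0) (f N) (N * (B + a.cost + 1) + (a.cost + 1)) := by
  obtain ⟨σ', h, rfl⟩ := Steps.while (w := w) (p := p) (B := B) (a := a) (σ := f 0) (N := N)
    (fun j σ => σ = f j) (fun j hj σ hσ => by rw [hσ]; exact hcond j hj)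
    (fun j hj σ hσ => ⟨f (j + 1), by rw [hσ]; exact hbody j hj, rfl⟩) rfl
  exact h

end Steps

/-! ### The memory layout -/

/-- The variables of the program: words, the output array, and real numbers. -/
structure Mem where
  n : ℕ
  M : ℕ
  J : ℕ
  q : ℕ
  k : ℕ
  z : ℕ
  s : ℕ
  kk : ℕ
  zz : ℕ
  x : ℕ
  g : ℕ → ℝ
  mu : ℝ
  r : ℝ
  p : ℝ
  R : ℕ → ℝ

namespace Mem

/-- These are the indices used by `wvar` and `assign`. In the loops over directions, 6 is the
direction, and 7 and 8 hold what is left of the mode number and of the vertex number after stripping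
digits. -/
def var (a : Mem) : ℕ → ℕ
  | 0 => a.n
  | 1 => a.M
  | 2 => a.J
  | 3 => a.q
  | 4 => a.k
  | 5 => a.z
  | 6 => a.s
  | 7 => a.kk
  | 8 => a.zz
  | 9 => a.x
  | _ => 0

def setVar (a : Mem) (i v : ℕ) : Mem :=
  match i with
  | 0 => { a with n := v }
  | 1 => { a with M := v }
  | 2 => { a with J := v }
  | 3 => { a with q := v }
  | 4 => { a with k := v }
  | 5 => { a with z := v }
  | 6 => { a with s := v }
  | 7 => { a with kk := v }
  | 8 => { a with zz := v }
  | 9 => { a with x := v }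
  | _ => a

def aux (a : Mem) : ℕ → ℝ
  | 0 => a.mu
  | 1 => a.r
  | 2 => a.p
  | i + 3 => a.R i

noncomputable def setAux (a : Mem) (i : ℕ) (v : ℝ) : Mem :=
  match i with
  | 0 => { a with mu := v }
  | 1 => { a with r := v }
  | 2 => { a with p := v }
  | i + 3 => { a with R := Function.update a.R i v }

theorem var_setVar (a : Mem) {i : ℕ} (hi : i < 10) (v j : ℕ) :
    (a.setVar i v).var j = if j = i then v else a.var j := by
  by_cases hj : j < 10
  · interval_cases i <;> interval_cases j <;> rfl
  · obtain ⟨l, rfl⟩ : ∃ l, j = l + 10 := ⟨j - 10, by omega⟩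
    rw [if_neg (by omega)]
    rfl

theorem aux_setVar (a : Mem) (i v : ℕ) : (a.setVar i v).aux = a.aux := by
  unfold setVar
  split <;> rfl

theorem g_setVar (a : Mem) (i v : ℕ) : (a.setVar i v).g = a.g := by
  unfold setVar
  split <;> rfl

theorem aux_setAux (a : Mem) (i : ℕ) (v : ℝ) :
    (a.setAux i v).aux = Function.update a.aux i v := by
  funext j
  match i, j with
  | 0, 0 | 0, 1 | 0, 2 | 0, j + 3 | 1, 0 | 1, 1 | 1, 2 | 1, j + 3 | 2, 0 | 2, 1 | 2, 2 | 2, j + 3 =>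
    simp [setAux, aux]
  | i + 3, 0 | i + 3, 1 | i + 3, 2 => simp [setAux, aux]
  | i + 3, j + 3 =>
    simp only [setAux, aux, Function.update_apply, Nat.add_right_cancel_iff]

theorem var_setAux (a : Mem) (i : ℕ) (v : ℝ) : (a.setAux i v).var = a.var := by
  unfold setAux
  split <;> rfl

theorem g_setAux (a : Mem) (i : ℕ) (v : ℝ) : (a.setAux i v).g = a.g := by
  unfold setAux
  split <;> rfl

end Mem

/-- The machine state in which the input `t, mm 0, …, mm (t - 1)` is followed by the word variables,
and the output array of length `N` by the real variables. -/
def enc (t : ℕ) (mm : ℕ → ℕ) (N : ℕ) (a : Mem) : State where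
  word i := if i = 0 then t else if i ≤ t then mm (i - 1) else a.var (i - (t + 1))
  real i := if i < N then a.g i else a.aux (i - N)

/-- The parameters of a run fit into words of `w` bits. -/
structure Fits (w t N : ℕ) (mm : ℕ → ℕ) : Prop where
  three_le : 3 ≤ N
  t_le : t ≤ N
  one_le : ∀ s < t, 1 ≤ mm s
  le : ∀ s < t, mm s ≤ N
  word : 100 * N ≤ 2 ^ w

/-- The address of the word variable `i`. -/
def wordAddr (i : ℕ) : WordExpr := .add (.load (.const 0)) (.const (i + 1))

/-- The word variable `i`. -/
def wvar (i : ℕ) : WordExpr := .load (wordAddr i)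

/-- The length of the current cycle. -/
def curLen : WordExpr := .load (.add (.const 1) (wvar 6))

/-- Whether the current direction differs from the direction of the longest cycle. -/
def curNe : WordExpr := .add (.lt (wvar 6) (wvar 2)) (.lt (wvar 2) (wvar 6))

/-- The length of the current cycle, or `1` for the longest cycle. -/
def curRed : WordExpr := .add (.const 1) (.mul (.sub curLen (.const 1)) curNe)

/-- The real variable with the number `e`. -/
def realAddr (e : WordExpr) : WordExpr := .add (wvar 0) e

def assign (i : ℕ) (e : WordExpr) : Program := .setWord (wordAddr i) e

def rvar (e : WordExpr) : RealExpr := .load (realAddr e)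

def rconst (k : ℕ) : RealExpr := .ofWord (.const k)

/-- The address of the number `e` in the table of powers. -/
def tableIndex (e : WordExpr) : WordExpr := .add (.const 3) e

/-! ### Overflow-free evaluation and single assignments -/

section Eval

variable {w t N : ℕ} {mm : ℕ → ℕ} {a : Mem}

/-- The expression `e` has the value `x`, without overflow. -/
def EvalsTo (w : ℕ) (σ : State) (e : WordExpr) (x : ℕ) : Prop := e.eval w σ = x ∧ x < 2 ^ w

variable {σ : State} {d e : WordExpr} {x y : ℕ}

theorem EvalsTo.const {k : ℕ} (hk : k < 2 ^ w) : EvalsTo w σ (.const k) k :=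
  ⟨Nat.mod_eq_of_lt hk, hk⟩

theorem EvalsTo.add (hd : EvalsTo w σ d x) (he : EvalsTo w σ e y) (h : x + y < 2 ^ w) :
    EvalsTo w σ (.add d e) (x + y) :=
  ⟨by rw [WordExpr.eval, hd.1, he.1, Nat.mod_eq_of_lt h], h⟩

theorem EvalsTo.sub (hd : EvalsTo w σ d x) (he : EvalsTo w σ e y) :
    EvalsTo w σ (.sub d e) (x - y) :=
  ⟨by rw [WordExpr.eval, hd.1, he.1], (Nat.sub_le _ _).trans_lt hd.2⟩

theorem EvalsTo.mul (hd : EvalsTo w σ d x) (he : EvalsTo w σ e y) (h : x * y < 2 ^ w) :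
    EvalsTo w σ (.mul d e) (x * y) :=
  ⟨by rw [WordExpr.eval, hd.1, he.1, Nat.mod_eq_of_lt h], h⟩

theorem EvalsTo.div (hd : EvalsTo w σ d x) (he : EvalsTo w σ e y) :
    EvalsTo w σ (.div d e) (x / y) :=
  ⟨by rw [WordExpr.eval, hd.1, he.1], (Nat.div_le_self _ _).trans_lt hd.2⟩

theorem EvalsTo.mod (hd : EvalsTo w σ d x) (he : EvalsTo w σ e y) :
    EvalsTo w σ (.mod d e) (x % y) :=
  ⟨by rw [WordExpr.eval, hd.1, he.1], (Nat.mod_le _ _).trans_lt hd.2⟩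

theorem EvalsTo.lt (hw : 1 < 2 ^ w) (hd : EvalsTo w σ d x) (he : EvalsTo w σ e y) :
    EvalsTo w σ (.lt d e) (if x < y then 1 else 0) := by
  have h : (if x < y then 1 else 0) < 2 ^ w := by split_ifs <;> omega
  exact ⟨by rw [WordExpr.eval, hd.1, he.1, Nat.mod_eq_of_lt h], h⟩

theorem EvalsTo.congr (he : EvalsTo w σ e x) (h : x = y) : EvalsTo w σ e y := h ▸ he

theorem lt_cond (hw : 1 < 2 ^ w) (hd : EvalsTo w σ d x) (he : EvalsTo w σ e y) :
    (WordExpr.lt d e).eval w σ ≠ 0 ↔ x < y := by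
  rw [(EvalsTo.lt hw hd he).1]
  split_ifs with h <;> simp [h]

theorem evalsTo_len (h : Fits w t N mm) : EvalsTo w (enc t mm N a) (.load (.const 0)) t := by
  have h1 := h.word
  have h2 := h.three_le
  have h3 := h.t_le
  have e : (0 : ℕ) % 2 ^ w = 0 := Nat.zero_mod _
  refine ⟨?_, by omega⟩
  rw [WordExpr.eval, WordExpr.eval, e]
  exact Nat.mod_eq_of_lt (by simp only [enc, if_true]; omega)

theorem evalsTo_wordAddr (h : Fits w t N mm) {i : ℕ} (hi : i < 10) :
    EvalsTo w (enc t mm N a) (wordAddr i) (t + (i + 1)) := by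
  have h1 := h.word
  have h2 := h.three_le
  have h3 := h.t_le
  exact (evalsTo_len h).add (.const (by omega)) (by omega)

theorem evalsTo_wvar (h : Fits w t N mm) {i : ℕ} (hi : i < 10) (hv : a.var i < 2 ^ w) :
    EvalsTo w (enc t mm N a) (wvar i) (a.var i) := by
  refine ⟨?_, hv⟩
  rw [wvar, WordExpr.eval, (evalsTo_wordAddr h hi).1]
  have : (enc t mm N a).word (t + (i + 1)) = a.var i := by
    simp only [enc]
    rw [if_neg (by omega), if_neg (by omega)]
    congr 1
    omega
  rw [this, Nat.mod_eq_of_lt hv]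

theorem evalsTo_curLen (h : Fits w t N mm) (hs : a.s < t) :
    EvalsTo w (enc t mm N a) curLen (mm a.s) := by
  have h1 := h.word
  have h2 := h.three_le
  have h3 := h.t_le
  have h4 := h.le _ hs
  have hv : mm a.s < 2 ^ w := by omega
  refine ⟨?_, hv⟩
  have e := (EvalsTo.const (σ := enc t mm N a) (k := 1) (by omega)).add
    (evalsTo_wvar (i := 6) (a := a) h (by omega) (show a.s < 2 ^ w by omega))
    (show 1 + a.s < 2 ^ w by omega)
  rw [curLen, WordExpr.eval, e.1]
  have : (enc t mm N a).word (1 + a.s) = mm a.s := by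
    simp only [enc]
    rw [if_neg (by omega), if_pos (by omega)]
    congr 1
    omega
  exact (congrArg (· % 2 ^ w) this).trans (Nat.mod_eq_of_lt hv)

theorem evalsTo_curNe (h : Fits w t N mm) (hs : a.s < t) (hJ : a.J < t) :
    EvalsTo w (enc t mm N a) curNe (if a.s = a.J then 0 else 1) := by
  have h1 := h.word
  have h2 := h.three_le
  have h3 := h.t_le
  have es := evalsTo_wvar (i := 6) (a := a) h (by omega) (show a.s < 2 ^ w by omega)
  have eJ := evalsTo_wvar (i := 2) (a := a) h (by omega) (show a.J < 2 ^ w by omega)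
  refine ((EvalsTo.lt (by omega) es eJ).add (EvalsTo.lt (by omega) eJ es) ?_).congr ?_
  · split_ifs <;> omega
  · simp only [Mem.var]
    split_ifs <;> omega

theorem evalsTo_curRed (h : Fits w t N mm) (hs : a.s < t) (hJ : a.J < t) :
    EvalsTo w (enc t mm N a) curRed (if a.s = a.J then 1 else mm a.s) := by
  have h1 := h.word
  have h2 := h.three_le
  have h4 := h.le _ hs
  have h5 := h.one_le _ hs
  refine ((EvalsTo.const (by omega)).add
    (((evalsTo_curLen h hs).sub (.const (by omega))).mul (evalsTo_curNe h hs hJ) ?_) ?_).congr ?_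
  all_goals split_ifs <;> omega

theorem evalsTo_realAddr (h : Fits w t N mm) (ha : a.n = N) {i : ℕ} {e : WordExpr}
    (he : EvalsTo w (enc t mm N a) e i) (hi : i ≤ 10 * N) :
    EvalsTo w (enc t mm N a) (realAddr e) (N + i) := by
  have h1 := h.word
  have h2 := h.three_le
  have en := evalsTo_wvar (i := 0) (a := a) h (by omega) (show a.n < 2 ^ w by omega)
  exact (en.congr ha).add he (by omega)

theorem eval_rvar (h : Fits w t N mm) (ha : a.n = N) {i : ℕ} {e : WordExpr}
    (he : EvalsTo w (enc t mm N a) e i) (hi : i ≤ 10 * N) :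
    (rvar e).eval w (enc t mm N a) = a.aux i := by
  rw [rvar, RealExpr.eval, (evalsTo_realAddr h ha he hi).1]
  simp only [enc]
  rw [if_neg (by omega), Nat.add_sub_cancel_left]

theorem eval_rconst {k : ℕ} (hk : k < 2 ^ w) : (rconst k).eval w σ = k := by
  rw [rconst, RealExpr.eval, (EvalsTo.const hk).1]

theorem EvalsTo.ofWord (he : EvalsTo w σ e x) : (RealExpr.ofWord e).eval w σ = x := by
  rw [RealExpr.eval, he.1]

theorem steps_assign (h : Fits w t N mm) {i : ℕ} (hi : i < 10) (he : EvalsTo w (enc t mm N a) e x) :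
    Steps w (assign i e) (enc t mm N a) (enc t mm N (a.setVar i x)) (e.cost + 5) := by
  refine ⟨_, ?_, (?_ : Exec w _ _ _ (((wordAddr i).cost + e.cost + 1)))⟩
  · simp only [wordAddr, WordExpr.cost]; omega
  · rw [assign]
    have := Exec.setWord (w := w) (wordAddr i) e (enc t mm N a)
    convert this using 1
    rw [(evalsTo_wordAddr h hi).1, he.1]
    simp only [enc, State.mk.injEq, Mem.aux_setVar, Mem.g_setVar, and_true]
    funext j
    rw [Function.update_apply]
    split_ifs with h1 h2 h3 h4 h5
    all_goals try omega
    · rw [Mem.var_setVar a hi, if_pos (by omega)]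
    · rw [Mem.var_setVar a hi, if_neg (by omega)]

/-- The base address of the real variables is read from the word variable `n`, so they are
accessible only once `n` holds the number of vertices. -/
theorem steps_setAux (h : Fits w t N mm) (ha : a.n = N) {i : ℕ} {v : RealExpr} {y : ℝ}
    (he : EvalsTo w (enc t mm N a) e i) (hi : i ≤ 10 * N) (hv : v.eval w (enc t mm N a) = y) :
    Steps w (.setReal (realAddr e) v) (enc t mm N a) (enc t mm N (a.setAux i y))
      ((realAddr e).cost + v.cost + 1) := by
  refine ⟨_, le_rfl, ?_⟩
  have := Exec.setReal (w := w) (realAddr e) v (enc t mm N a)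
  convert this using 1
  rw [(evalsTo_realAddr h ha he hi).1, hv]
  simp only [enc, State.mk.injEq, Mem.var_setAux, Mem.g_setAux, Mem.aux_setAux, true_and]
  funext j
  simp only [Function.update_apply]
  split_ifs
  all_goals first
    | omega
    | rfl

theorem steps_setOut {v : RealExpr} {y : ℝ} (hx : x < N)
    (he : EvalsTo w (enc t mm N a) e x) (hv : v.eval w (enc t mm N a) = y) :
    Steps w (.setReal e v) (enc t mm N a) (enc t mm N { a with g := Function.update a.g x y })
      (e.cost + v.cost + 1) := by
  refine ⟨_, le_rfl, ?_⟩
  have := Exec.setReal (w := w) e v (enc t mm N a)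
  convert this using 1
  rw [he.1, hv]
  simp only [enc, State.mk.injEq]
  refine ⟨rfl, ?_⟩
  funext j
  simp only [Function.update_apply]
  split_ifs
  all_goals first
    | omega
    | rfl

end Eval

/-! ### The program -/

/-- Find the number `n` of vertices and a longest cycle. -/
def scanBody : Program :=
  .seq (assign 0 (.mul (wvar 0) curLen)) (.seq
    (.ifWord (.lt (wvar 1) curLen)
      -- The second branch assigns a variable to itself, as a substitute for an empty program.
      (.seq (assign 2 (wvar 6)) (assign 1 curLen)) (assign 6 (wvar 6)))
    (assign 6 (.add (wvar 6) (.const 1))))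

def dirLoop (body : Program) : Program := .while (.lt (wvar 6) (.load (.const 0))) body

/-- The direction, the maximum and its position start from the zeros of the initial memory; only the
product needs the start value `1`. -/
def scan : Program :=
  .seq (assign 0 (.const 1)) (.seq (dirLoop scanBody) (assign 3 (.div (wvar 0) (wvar 1))))

/-- Add the contribution of one direction to the eigenvalue of the current mode. -/
def eigBody : Program :=
  .seq (.setReal (realAddr (.const 0))
    (.add (rvar (.const 0)) (.sub (rconst 2) (.mul (rconst 2) (.cos (.div
      (.mul (.mul (rconst 2) .pi) (.ofWord (.mod (wvar 7) curRed))) (.ofWord curLen)))))))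
    (.seq (assign 7 (.div (wvar 7) curRed)) (assign 6 (.add (wvar 6) (.const 1))))

def eig : Program :=
  .seq (assign 6 (.const 0)) (.seq (assign 7 (wvar 4))
    (.seq (.setReal (realAddr (.const 0)) (rconst 0)) (dirLoop eigBody)))

/-- `2 + μ` for the eigenvalue `μ` of the current mode. -/
def shiftedEig : RealExpr := .add (rconst 2) (rvar (.const 0))

def root : Program :=
  .setReal (realAddr (.const 1)) (.div
    (.sub shiftedEig (.sqrt (.sub (.mul shiftedEig shiftedEig) (rconst 4)))) (rconst 2))

def tableBody : Program :=
  .seq (.setReal (realAddr (tableIndex (.add (wvar 9) (.const 1))))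
    (.mul (rvar (tableIndex (wvar 9))) (rvar (.const 1))))
    (assign 9 (.add (wvar 9) (.const 1)))

/-- Write the powers of `r` into a table. -/
def table : Program :=
  .seq (assign 9 (.const 0)) (.seq (.setReal (realAddr (tableIndex (.const 0))) (rconst 1))
    (.while (.lt (wvar 9) (wvar 1)) tableBody))

/-- Multiply by the mode in one direction, and extract the coordinate in the longest direction. -/
def digitBody : Program :=
  .seq (.setReal (realAddr (.const 2)) (.mul (rvar (.const 2)) (.cos (.div
      (.mul (.mul (rconst 2) .pi) (.mul (.ofWord (.mod (wvar 7) curRed))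
        (.ofWord (.mod (wvar 8) curLen)))) (.ofWord curLen)))))
    -- The factor `1 - curNe` is `1` in the longest direction only. There `curRed` is `1`, so the
    -- frequency digit is `0` and the cosine above is `1`.
    (.seq (assign 9 (.add (wvar 9) (.mul (.mod (wvar 8) curLen) (.sub (.const 1) curNe))))
      (.seq (assign 7 (.div (wvar 7) curRed)) (.seq (assign 8 (.div (wvar 8) curLen))
        (assign 6 (.add (wvar 6) (.const 1))))))

def digits : Program :=
  .seq (assign 6 (.const 0)) (.seq (assign 7 (wvar 4)) (.seq (assign 8 (wvar 5))
    (.seq (assign 9 (.const 0)) (.seq (.setReal (realAddr (.const 2)) (rconst 1))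
      (dirLoop digitBody)))))

/-- The value of `cycleGreen`. -/
def greenExpr : RealExpr :=
  .sub (.div (.sub (.mul (.ofWord (wvar 1)) (.ofWord (wvar 1))) (rconst 1))
      (.mul (rconst 12) (.ofWord (wvar 1))))
    (.div (.mul (.ofWord (wvar 9)) (.sub (.ofWord (wvar 1)) (.ofWord (wvar 9))))
      (.mul (rconst 2) (.ofWord (wvar 1))))

/-- The value of `cycleResolvent`. -/
def resolventExpr : RealExpr :=
  .div (.add (rvar (tableIndex (wvar 9))) (rvar (tableIndex (.sub (wvar 1) (wvar 9)))))
    (.mul (.sub (rconst 1) (rvar (tableIndex (wvar 1))))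
      (.sub (.div (rconst 1) (rvar (.const 1))) (rvar (.const 1))))

/-- Add the value of the current mode at the current vertex to the output. -/
def accumulate (scale : WordExpr) (v : RealExpr) : Program :=
  .setReal (wvar 5) (.add (.load (wvar 5))
    (.mul (.ofWord scale) (.div (.mul (rvar (.const 2)) v) (.ofWord (wvar 3)))))

def pointBody (scale : WordExpr) : Program :=
  .seq digits (.seq
    (.ifWord (wvar 4) (accumulate scale resolventExpr) (accumulate scale greenExpr))
    (assign 5 (.add (wvar 5) (.const 1))))

def points (scale : WordExpr) : Program :=
  .seq (assign 5 (.const 0)) (.while (.lt (wvar 5) (wvar 0)) (pointBody scale))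

/-- For the zero mode, `root` yields `1`, where the resolvent formula degenerates; `pointBody` then
uses `greenExpr` and ignores the table. -/
def modeBody (scale : WordExpr) : Program :=
  .seq eig (.seq root (.seq table (.seq (points scale) (assign 4 (.add (wvar 4) (.const 1))))))

/-- The program that computes the first row of the Green's function of a torus. -/
def greenProgram (scale : WordExpr) : Program :=
  .seq scan (.while (.lt (wvar 4) (wvar 3)) (modeBody scale))

/-- The digit number `s` of `z` in the mixed radix system `f`. -/
def digit (f : ℕ → ℕ) (z s : ℕ) : ℕ := z / (∏ i ∈ Finset.range s, f i) % f s

/-- The radices `mm` with `mm J` replaced by `1`. -/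
def redRadix (mm : ℕ → ℕ) (J s : ℕ) : ℕ := if s = J then 1 else mm s

/-! ### Effect and running time of each piece of the program -/

section Specs

variable {w t N : ℕ} {mm : ℕ → ℕ}

theorem Fits.one_lt (h : Fits w t N mm) : 1 < 2 ^ w := by
  have h1 := h.word
  have h2 := h.three_le
  omega

theorem Fits.lt_of_le (h : Fits w t N mm) {x : ℕ} (hx : x ≤ 50 * N) : x < 2 ^ w := by
  have h1 := h.word
  have h2 := h.three_le
  omega

theorem Fits.const (h : Fits w t N mm) {σ : State} {x : ℕ} (hx : x ≤ 12) :
    EvalsTo w σ (.const x) x :=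
  .const (h.lt_of_le (by have := h.three_le; omega))

theorem Fits.rconst (h : Fits w t N mm) {σ : State} {x : ℕ} (hx : x ≤ 12) :
    (rconst x).eval w σ = x :=
  eval_rconst (h.lt_of_le (by have := h.three_le; omega))

theorem Fits.wvar (h : Fits w t N mm) {a : Mem} {i : ℕ} (hi : i < 10) {x : ℕ}
    (hx : a.var i = x) (hv : x ≤ 50 * N) : EvalsTo w (enc t mm N a) (wvar i) x := by
  subst hx
  exact evalsTo_wvar h hi (h.lt_of_le hv)

theorem Steps.congr {p : Program} {σ σ' σ'' : State} {A : ℕ} (h : Steps w p σ σ' A)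
    (h' : σ' = σ'') : Steps w p σ σ'' A := h' ▸ h

/-- A loop over the directions. -/
theorem steps_dirLoop (h : Fits w t N mm) {body : Program} {B : ℕ} (f : ℕ → Mem)
    (hs : ∀ j ≤ t, (f j).s = j)
    (hbody : ∀ j < t, Steps w body (enc t mm N (f j)) (enc t mm N (f (j + 1))) B) :
    Steps w (dirLoop body) (enc t mm N (f 0)) (enc t mm N (f t)) (t * (B + 9) + 9) := by
  refine Steps.while_of_fun (fun j => enc t mm N (f j)) (fun j hj => ?_) hbody
  have := h.t_le
  exact lt_cond h.one_lt (h.wvar (by omega) (hs j hj) (by omega)) (evalsTo_len h)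

/-- The greatest length among the first cycles, and its position. -/
def longest (mm : ℕ → ℕ) : ℕ → ℕ × ℕ
  | 0 => (0, 0)
  | j + 1 => if (longest mm j).1 < mm j then (mm j, j) else longest mm j

theorem longest_fst_le (h : Fits w t N mm) {j : ℕ} (hj : j ≤ t) : (longest mm j).1 ≤ N := by
  induction j with
  | zero => exact Nat.zero_le _
  | succ j ih =>
    rw [longest]
    split_ifs
    · exact h.le j hj
    · exact ih (by omega)

theorem longest_spec (h : Fits w t N mm) {j : ℕ} (hj : j ≤ t) (hj0 : 0 < j) :
    (longest mm j).2 < j ∧ mm (longest mm j).2 = (longest mm j).1 ∧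
      ∀ i < j, mm i ≤ (longest mm j).1 := by
  induction j with
  | zero => omega
  | succ j ih =>
    rw [longest]
    have h1 := h.one_le j hj
    rcases Nat.eq_zero_or_pos j with rfl | hpos
    -- Lengths are at least `1`, so the first cycle always replaces the initial maximum `0`.
    · rw [longest, if_pos (show ((0, 0) : ℕ × ℕ).1 < mm 0 from h1)]
      refine ⟨by simp, rfl, fun i hi => ?_⟩
      rw [Nat.lt_one_iff.1 hi]
    · obtain ⟨i1, i2, i3⟩ := ih (by omega) hpos
      split_ifs with hlt
      · refine ⟨by simp, rfl, fun i hi => ?_⟩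
        rcases Nat.lt_succ_iff_lt_or_eq.1 hi with h' | rfl
        · exact (i3 i h').trans hlt.le
        · exact le_rfl
      · refine ⟨by omega, i2, fun i hi => ?_⟩
        rcases Nat.lt_succ_iff_lt_or_eq.1 hi with h' | rfl
        · exact i3 i h'
        · exact not_lt.1 hlt

theorem steps_scanBody (h : Fits w t N mm) {a : Mem} (hs : a.s < t) (hn : a.n * mm a.s ≤ N)
    (hM : a.M ≤ N) :
    Steps w scanBody (enc t mm N a)
      (enc t mm N { a with
        n := a.n * mm a.s
        M := if a.M < mm a.s then mm a.s else a.M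
        J := if a.M < mm a.s then a.s else a.J
        s := a.s + 1 }) 100 := by
  have ht := h.t_le
  have h1 := h.one_le _ hs
  have h2 := h.le _ hs
  have hn' : a.n ≤ N := (Nat.le_mul_of_pos_right _ h1).trans hn
  have s1 := steps_assign (a := a) (i := 0) h (by omega)
    ((h.wvar (i := 0) (x := a.n) (by omega) rfl (by omega)).mul (evalsTo_curLen h hs)
      (h.lt_of_le (by omega)))
  set b := a.setVar 0 (a.n * mm a.s) with hb
  have eM : EvalsTo w (enc t mm N b) (wvar 1) a.M := h.wvar (by omega) rfl (by omega)
  have eL : EvalsTo w (enc t mm N b) curLen (mm a.s) := evalsTo_curLen (a := b) h hs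
  have es : ∀ c : Mem, c.s = a.s → EvalsTo w (enc t mm N c) (wvar 6) a.s := fun c hc =>
    h.wvar (by omega) hc (by omega)
  have s3 : ∀ c : Mem, c.s = a.s → Steps w (assign 6 (.add (wvar 6) (.const 1))) (enc t mm N c)
      (enc t mm N { c with s := a.s + 1 }) _ := fun c hc =>
    steps_assign (i := 6) h (by omega) ((es c hc).add (h.const (by omega)) (h.lt_of_le (by omega)))
  have hc := lt_cond h.one_lt eM eL
  by_cases hlt : a.M < mm a.s
  · simp only [if_pos hlt]
    refine ((s1.seq ((Steps.ifWord_true (hc.2 hlt) ((steps_assign (i := 2) h (by omega)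
      (es b rfl)).seq (steps_assign (i := 1) h (by omega) (evalsTo_curLen h hs)))).seq
      (s3 _ rfl))).mono ?_)
    -- All costs in this piece are closed numerals.
    decide
  · simp only [if_neg hlt]
    refine ((s1.seq ((Steps.ifWord_false (not_not.1 (mt hc.1 hlt)) (steps_assign (i := 6) h
      (by omega) (es b rfl))).seq (s3 _ rfl))).mono ?_)
    decide

theorem steps_incr (h : Fits w t N mm) {a : Mem} {i x : ℕ} (hi : i < 10) (hx : a.var i = x)
    (hv : x ≤ N) :
    Steps w (assign i (.add (wvar i) (.const 1))) (enc t mm N a)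
      (enc t mm N (a.setVar i (x + 1))) 13 := by
  have h3 := h.three_le
  refine (steps_assign h hi ((h.wvar hi hx (by omega)).add (h.const (x := 1) (by omega))
    (h.lt_of_le (by omega)))).mono ?_
  simp only [wvar, wordAddr, WordExpr.cost]
  omega

/-- The initial contents of the variables. -/
def initMem : Mem := ⟨0, 0, 0, 0, 0, 0, 0, 0, 0, 0, fun _ => 0, 0, 0, 0, fun _ => 0⟩

theorem steps_scan (h : Fits w t N mm) (hN : N = ∏ i ∈ Finset.range t, mm i) :
    Steps w scan (enc t mm N initMem)
      (enc t mm N { initMem with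
        n := N
        M := (longest mm t).1
        J := (longest mm t).2
        q := N / (longest mm t).1
        s := t }) (t * 109 + 40) := by
  have s1 := steps_assign (a := initMem) (i := 0) h (by omega) (h.const (x := 1) (by omega))
  -- Partial products divide `N`, so the running product cannot overflow.
  have hle : ∀ j ≤ t, ∏ i ∈ Finset.range j, mm i ≤ N := fun j hj => by
    refine Nat.le_of_dvd (by have := h.three_le; omega) ?_
    rw [hN]
    exact Finset.prod_dvd_prod_of_subset _ _ _ (Finset.range_subset_range.2 hj)
  have s2 := steps_dirLoop (body := scanBody) (B := 100) h
    (fun j => { initMem with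
      n := ∏ i ∈ Finset.range j, mm i
      M := (longest mm j).1
      J := (longest mm j).2
      s := j }) (fun _ _ => rfl) (fun j hj => by
        refine (steps_scanBody h hj ?_ (longest_fst_le h hj.le)).congr ?_
        · exact (Finset.prod_range_succ mm j).symm.trans_le (hle (j + 1) hj)
        · congr 2
          · exact (Finset.prod_range_succ mm j).symm
          · rw [longest]; split_ifs <;> rfl
          · rw [longest]; split_ifs <;> rfl)
  rw [← hN] at s2
  have s3 := steps_assign (i := 3) (t := t) (N := N)
    (a := { initMem with n := N, M := (longest mm t).1, J := (longest mm t).2, s := t }) h (by omega)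
    ((h.wvar (i := 0) (x := N) (by omega) rfl (by omega)).div (h.wvar (i := 1)
      (x := (longest mm t).1) (by omega) rfl (by have := longest_fst_le h le_rfl; omega)))
  refine (s1.seq (s2.seq s3)).mono ?_
  simp only [wvar, wordAddr, WordExpr.cost]
  omega

theorem steps_eigBody (h : Fits w t N mm) {a : Mem} (hn : a.n = N) (hs : a.s < t) (hJ : a.J < t)
    (hk : a.kk ≤ N) :
    Steps w eigBody (enc t mm N a)
      (enc t mm N { a with
        mu := a.mu + (2 - 2 * Real.cos (2 * Real.pi
          * ((a.kk % redRadix mm a.J a.s : ℕ) : ℝ) / (mm a.s : ℝ)))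
        kk := a.kk / redRadix mm a.J a.s
        s := a.s + 1 }) 200 := by
  have h3 := h.three_le
  have ht := h.t_le
  have ek : ∀ b : Mem, b.kk = a.kk → EvalsTo w (enc t mm N b) (wvar 7) a.kk := fun b hb =>
    h.wvar (by omega) hb (by omega)
  have eR : ∀ b : Mem, b.J = a.J → b.s = a.s →
      EvalsTo w (enc t mm N b) curRed (redRadix mm a.J a.s) := fun b hb hb' => by
    have := evalsTo_curRed (a := b) h (by omega) (by omega)
    rwa [hb, hb'] at this
  set Y : ℝ := a.mu + (2 - 2 * Real.cos (2 * Real.pi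
          * ((a.kk % redRadix mm a.J a.s : ℕ) : ℝ) / (mm a.s : ℝ)))
  have s1 := steps_setAux (a := a) (e := .const 0) (i := 0) h hn (h.const (by omega)) (by omega)
    (v := .add (rvar (.const 0)) (.sub (rconst 2) (.mul (rconst 2) (.cos (.div
      (.mul (.mul (rconst 2) .pi) (.ofWord (.mod (wvar 7) curRed))) (.ofWord curLen))))))
    (y := Y) (by
      simp only [RealExpr.eval, eval_rvar h hn (h.const (x := 0) (by omega)) (by omega),
        h.rconst (x := 2) (by omega), ((ek a rfl).mod (eR a rfl rfl)).1, (evalsTo_curLen h hs).1]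
      rfl)
  refine (s1.seq ((steps_assign (i := 7) (a := a.setAux 0 Y) h (by omega)
    ((ek (a.setAux 0 Y) rfl).div (eR (a.setAux 0 Y) rfl rfl))).seq
    (steps_incr (i := 6) h (by omega) rfl (show a.s ≤ N by omega)))).mono ?_
  decide

theorem div_prod_range_succ {f : ℕ → ℕ} (k j : ℕ) :
    k / (∏ i ∈ Finset.range j, f i) / f j = k / ∏ i ∈ Finset.range (j + 1), f i := by
  rw [Nat.div_div_eq_div_mul, Finset.prod_range_succ]

/-- The eigenvalue of the mode number `k`. -/
noncomputable def eigValue (mm : ℕ → ℕ) (t J k : ℕ) : ℝ :=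
  ∑ i ∈ Finset.range t,
    (2 - 2 * Real.cos (2 * Real.pi * (digit (redRadix mm J) k i : ℝ) / (mm i : ℝ)))

theorem steps_eig (h : Fits w t N mm) {a : Mem} (hn : a.n = N) (hJ : a.J < t) (hk : a.k ≤ N) :
    Steps w eig (enc t mm N a)
      (enc t mm N { a with
        mu := eigValue mm t a.J a.k
        kk := a.k / ∏ i ∈ Finset.range t, redRadix mm a.J i
        s := t }) (t * 209 + 50) := by
  have h3 := h.three_le
  have s1 := steps_assign (a := a) (i := 6) h (by omega) (h.const (x := 0) (by omega))
  have s2 := steps_assign (a := { a with s := 0 }) (i := 7) (x := a.k) h (by omega)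
    (h.wvar (i := 4) (by omega) rfl (by omega))
  have s3 := steps_setAux (a := { a with s := 0, kk := a.k }) (e := .const 0) (i := 0) (y := 0) h hn
    (h.const (by omega)) (by omega) ((h.rconst (x := 0) (by omega)).trans Nat.cast_zero)
  let f : ℕ → Mem := fun j => { a with
      mu := eigValue mm j a.J a.k
      kk := a.k / ∏ i ∈ Finset.range j, redRadix mm a.J i
      s := j }
  have s4 := steps_dirLoop (body := eigBody) (B := 200) h f (fun _ _ => rfl) (fun j hj => by
        refine (steps_eigBody (a := f j) h hn hj hJ ((Nat.div_le_self _ _).trans hk)).congr ?_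
        congr 2
        · exact div_prod_range_succ _ _
        · exact (Finset.sum_range_succ _ _).symm)
  have e : f 0 = { a with s := 0, kk := a.k, mu := 0 } := by
    simp [f, eigValue]
  rw [e] at s4
  refine (s1.seq (s2.seq (s3.seq s4))).mono ?_
  simp only [wvar, wordAddr, realAddr, rconst, WordExpr.cost, RealExpr.cost]
  omega

theorem steps_root (h : Fits w t N mm) {a : Mem} (hn : a.n = N) :
    Steps w root (enc t mm N a) (enc t mm N { a with r := smallRoot a.mu }) 100 := by
  have h3 := h.three_le
  refine (steps_setAux (a := a) (i := 1) (y := smallRoot a.mu) h hn (h.const (by omega)) (by omega)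
    ?_).mono ?_
  · simp only [RealExpr.eval, shiftedEig, eval_rvar h hn (h.const (x := 0) (by omega)) (by omega),
      h.rconst (x := 2) (by omega), h.rconst (x := 4) (by omega), Mem.aux, smallRoot]
    norm_num
  · decide

/-- The table of the first `j + 1` powers of `r`. -/
noncomputable def powTable (r : ℝ) (R : ℕ → ℝ) (j i : ℕ) : ℝ := if i ≤ j then r ^ i else R i

theorem evalsTo_tableIndex (h : Fits w t N mm) {σ : State} {e : WordExpr} {x : ℕ}
    (he : EvalsTo w σ e x) (hx : x ≤ 2 * N) : EvalsTo w σ (tableIndex e) (x + 3) := by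
  have h3 := h.three_le
  exact ((h.const (by omega)).add he (h.lt_of_le (by omega))).congr (add_comm _ _)

theorem steps_tableBody (h : Fits w t N mm) {a : Mem} (hn : a.n = N) (hx : a.x < N) :
    Steps w tableBody (enc t mm N a)
      (enc t mm N { a with
        R := Function.update a.R (a.x + 1) (a.R a.x * a.r)
        x := a.x + 1 }) 100 := by
  have h3 := h.three_le
  have ex : EvalsTo w (enc t mm N a) (wvar 9) a.x := h.wvar (by omega) rfl (by omega)
  have s1 := steps_setAux (a := a) (i := a.x + 1 + 3) (y := a.R a.x * a.r) h hn
    (evalsTo_tableIndex h (ex.add (h.const (x := 1) (by omega)) (h.lt_of_le (by omega))) (by omega))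
    (by omega) (v := .mul (rvar (tableIndex (wvar 9))) (rvar (.const 1))) (by
      rw [RealExpr.eval, eval_rvar h hn (evalsTo_tableIndex h ex (by omega)) (by omega),
        eval_rvar h hn (h.const (x := 1) (by omega)) (by omega)]
      rfl)
  refine (s1.seq (steps_incr (i := 9) h (by omega) rfl (show a.x ≤ N by omega))).mono ?_
  decide

theorem steps_table (h : Fits w t N mm) {a : Mem} (hn : a.n = N) (hM : a.M ≤ N) :
    Steps w table (enc t mm N a)
      (enc t mm N { a with R := powTable a.r a.R a.M, x := a.M }) (a.M * 113 + 50) := by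
  have h3 := h.three_le
  have s1 := steps_assign (a := a) (i := 9) h (by omega) (h.const (x := 0) (by omega))
  have s2 := steps_setAux (a := { a with x := 0 }) (i := 3) (y := 1) h hn
    (evalsTo_tableIndex (x := 0) h (h.const (by omega)) (by omega)) (by omega)
    ((h.rconst (x := 1) (by omega)).trans Nat.cast_one)
  have s3 := Steps.while_of_fun (w := w) (p := tableBody) (B := 100) (N := a.M)
    (a := .lt (wvar 9) (wvar 1))
    (fun j => enc t mm N { a with R := powTable a.r a.R j, x := j })
    (fun j hj => lt_cond h.one_lt (h.wvar (by omega) rfl (by omega)) (h.wvar (by omega) rfl (by omega)))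
    (fun j hj => by
      refine (steps_tableBody (a := { a with R := powTable a.r a.R j, x := j }) h hn
        (show j < N by omega)).congr ?_
      congr 2
      funext i
      simp only [Function.update_apply, powTable]
      split_ifs with h1 h2 h2 h2 h2
      all_goals first
        | omega
        | rfl
        | (rw [h1, pow_succ]))
  have e : powTable a.r a.R 0 = Function.update a.R 0 1 := by
    funext i
    rcases Nat.eq_zero_or_pos i with rfl | hi
    · simp [powTable]
    · rw [Function.update_of_ne hi.ne', powTable, if_neg (by omega)]
  rw [e] at s3
  refine (s1.seq (s2.seq s3)).mono ?_
  simp only [wvar, wordAddr, realAddr, tableIndex, rconst, WordExpr.cost, RealExpr.cost]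
  omega

theorem steps_digitBody (h : Fits w t N mm) {a : Mem} (hn : a.n = N) (hs : a.s < t) (hJ : a.J < t)
    (hk : a.kk ≤ N) (hz : a.zz ≤ N) (hx : a.x ≤ N) :
    Steps w digitBody (enc t mm N a)
      (enc t mm N { a with
        p := a.p * mode (mm a.s) (a.kk % redRadix mm a.J a.s) (a.zz % mm a.s)
        x := a.x + if a.s = a.J then a.zz % mm a.s else 0
        kk := a.kk / redRadix mm a.J a.s
        zz := a.zz / mm a.s
        s := a.s + 1 }) 300 := by
  have h3 := h.three_le
  have ht := h.t_le
  have ek : ∀ b : Mem, b.kk = a.kk → EvalsTo w (enc t mm N b) (wvar 7) a.kk := fun b hb =>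
    h.wvar (by omega) hb (by omega)
  have ez : ∀ b : Mem, b.zz = a.zz → EvalsTo w (enc t mm N b) (wvar 8) a.zz := fun b hb =>
    h.wvar (by omega) hb (by omega)
  have ex : ∀ b : Mem, b.x = a.x → EvalsTo w (enc t mm N b) (wvar 9) a.x := fun b hb =>
    h.wvar (by omega) hb (by omega)
  have eL : ∀ b : Mem, b.s = a.s → EvalsTo w (enc t mm N b) curLen (mm a.s) := fun b hb => by
    have := evalsTo_curLen (a := b) h (by omega)
    rwa [hb] at this
  have eR : ∀ b : Mem, b.J = a.J → b.s = a.s →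
      EvalsTo w (enc t mm N b) curRed (redRadix mm a.J a.s) := fun b hb hb' => by
    have := evalsTo_curRed (a := b) h (by omega) (by omega)
    rwa [hb, hb'] at this
  have eN : ∀ b : Mem, b.J = a.J → b.s = a.s →
      EvalsTo w (enc t mm N b) curNe (if a.s = a.J then 0 else 1) := fun b hb hb' => by
    have := evalsTo_curNe (a := b) h (by omega) (by omega)
    rwa [hb, hb'] at this
  have hzm : a.zz % mm a.s ≤ N := (Nat.mod_le _ _).trans hz
  set P : ℝ := a.p * mode (mm a.s) (a.kk % redRadix mm a.J a.s) (a.zz % mm a.s)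
  set X : ℕ := a.x + if a.s = a.J then a.zz % mm a.s else 0
  let b := a.setAux 2 P
  let c := b.setVar 9 X
  let d := c.setVar 7 (a.kk / redRadix mm a.J a.s)
  have s1 := steps_setAux (a := a) (e := .const 2) (i := 2) h hn (h.const (by omega)) (by omega)
    (v := .mul (rvar (.const 2)) (.cos (.div
      (.mul (.mul (rconst 2) .pi) (.mul (.ofWord (.mod (wvar 7) curRed))
        (.ofWord (.mod (wvar 8) curLen)))) (.ofWord curLen))))
    (y := P) (by
      simp only [RealExpr.eval, eval_rvar h hn (h.const (x := 2) (by omega)) (by omega),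
        h.rconst (x := 2) (by omega), ((ek a rfl).mod (eR a rfl rfl)).1,
        ((ez a rfl).mod (eL a rfl)).1, (eL a rfl).1]
      rfl)
  have s2 := steps_assign (i := 9) (x := X)
    (a := b)
    (e := .add (wvar 9) (.mul (.mod (wvar 8) curLen) (.sub (.const 1) curNe))) h (by omega) (by
      refine ((ex b rfl).add (((ez b rfl).mod (eL b rfl)).mul ((h.const (by omega)).sub
        (eN b rfl rfl)) (h.lt_of_le ?_)) (h.lt_of_le ?_)).congr ?_
      all_goals
        try simp only [X]
        split_ifs
        all_goals simp only [Nat.sub_zero, Nat.sub_self, Nat.mul_one, Nat.mul_zero]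
        all_goals omega)
  refine (s1.seq (s2.seq ((steps_assign (i := 7) (a := c) h (by omega) ((ek c rfl).div (eR c rfl rfl))).seq
    ((steps_assign (i := 8) (a := d) h (by omega) ((ez d rfl).div (eL d rfl))).seq
    (steps_incr (i := 6) h (by omega) rfl (show a.s ≤ N by omega)))))).mono ?_
  decide

/-- The value of the mode number `k` at the vertex number `z`, up to the longest direction. -/
noncomputable def modeProd (mm : ℕ → ℕ) (t J k z : ℕ) : ℝ :=
  ∏ i ∈ Finset.range t, mode (mm i) (digit (redRadix mm J) k i) (digit mm z i)

/-- The final values of `kk` and `zz` are irrelevant scratch and therefore existentially quantified.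
-/
theorem steps_digits (h : Fits w t N mm) {a : Mem} (hn : a.n = N) (hJ : a.J < t) (hk : a.k ≤ N)
    (hz : a.z ≤ N) :
    ∃ kk zz, Steps w digits (enc t mm N a)
      (enc t mm N { a with
        p := modeProd mm t a.J a.k a.z
        x := digit mm a.z a.J
        kk := kk
        zz := zz
        s := t }) (t * 309 + 100) := by
  have h3 := h.three_le
  have s1 := steps_assign (a := a) (i := 6) h (by omega) (h.const (x := 0) (by omega))
  have s2 := steps_assign (a := { a with s := 0 }) (i := 7) (x := a.k) h (by omega)
    (h.wvar (i := 4) (by omega) rfl (by omega))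
  have s3 := steps_assign (a := { a with s := 0, kk := a.k }) (i := 8) (x := a.z) h (by omega)
    (h.wvar (i := 5) (by omega) rfl (by omega))
  have s4 := steps_assign (a := { a with s := 0, kk := a.k, zz := a.z }) (i := 9) h (by omega)
    (h.const (x := 0) (by omega))
  have s5 := steps_setAux (a := { a with s := 0, kk := a.k, zz := a.z, x := 0 }) (e := .const 2)
    (i := 2) (y := 1) h hn (h.const (by omega)) (by omega)
    ((h.rconst (x := 1) (by omega)).trans Nat.cast_one)
  let f : ℕ → Mem := fun j => { a with
      p := modeProd mm j a.J a.k a.z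
      -- The coordinate is picked up when the loop passes direction `J`, and is `0` before.
      x := if a.J < j then digit mm a.z a.J else 0
      kk := a.k / ∏ i ∈ Finset.range j, redRadix mm a.J i
      zz := a.z / ∏ i ∈ Finset.range j, mm i
      s := j }
  have s6 := steps_dirLoop (body := digitBody) (B := 300) h f (fun _ _ => rfl) (fun j hj => by
        refine (steps_digitBody (a := f j) h hn hj hJ ((Nat.div_le_self _ _).trans hk)
          ((Nat.div_le_self _ _).trans hz) ?_).congr ?_
        · simp only [f, digit]
          split_ifs
          · exact (Nat.mod_le _ _).trans ((Nat.div_le_self _ _).trans hz)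
          · exact Nat.zero_le _
        · congr 2
          · exact div_prod_range_succ _ _
          · exact div_prod_range_succ _ _
          · change (if a.J < j then digit mm a.z a.J else 0) +
              (if j = a.J then a.z / (∏ i ∈ Finset.range j, mm i) % mm j else 0)
                = if a.J < j + 1 then digit mm a.z a.J else 0
            rcases lt_trichotomy a.J j with hlt | heq | hgt
            · rw [if_pos hlt, if_neg hlt.ne', if_pos (by omega), Nat.add_zero]
            · rw [if_neg (by omega), if_pos heq.symm, if_pos (by omega), Nat.zero_add, digit, heq]
            · rw [if_neg (by omega), if_neg (by omega), if_neg (by omega)]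
          · exact (Finset.prod_range_succ _ _).symm)
  have e : f 0 = { a with s := 0, kk := a.k, zz := a.z, x := 0, p := 1 } := by
    simp [f, modeProd]
  have e' : (f t).x = digit mm a.z a.J := if_pos hJ
  rw [e] at s6
  rw [← e']
  refine ⟨_, _, (s1.seq (s2.seq (s3.seq (s4.seq (s5.seq s6))))).mono ?_⟩
  simp only [wvar, wordAddr, realAddr, rconst, WordExpr.cost, RealExpr.cost]
  omega

/-- The value of a mode in the longest direction. -/
noncomputable def axialValue (M k : ℕ) (r : ℝ) (x : ℕ) : ℝ :=
  if k = 0 then cycleGreen M x else cycleResolvent M r x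

theorem steps_accumulate (h : Fits w t N mm) {a : Mem} (hn : a.n = N) (hz : a.z < N)
    (hq : a.q ≤ N) {scale : WordExpr} {S : ℕ} (hS : ∀ a, EvalsTo w (enc t mm N a) scale S)
    {v : RealExpr} {y : ℝ} (hv : v.eval w (enc t mm N a) = y) :
    Steps w (accumulate scale v) (enc t mm N a)
      (enc t mm N { a with
        g := Function.update a.g a.z (a.g a.z + (S : ℝ) * (a.p * y / (a.q : ℝ))) })
      (scale.cost + v.cost + 50) := by
  have h3 := h.three_le
  have ez : EvalsTo w (enc t mm N a) (wvar 5) a.z := h.wvar (by omega) rfl (by omega)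
  have eq : EvalsTo w (enc t mm N a) (wvar 3) a.q := h.wvar (by omega) rfl (by omega)
  refine (steps_setOut hz ez (y := a.g a.z + (S : ℝ) * (a.p * y / (a.q : ℝ))) ?_).mono ?_
  · simp only [RealExpr.eval, ez.1, (hS a).1, eq.1, hv,
      eval_rvar h hn (h.const (x := 2) (by omega)) (by omega)]
    simp only [enc, hz, if_true, Mem.aux]
  · simp only [rvar, wvar, wordAddr, realAddr, WordExpr.cost, RealExpr.cost]
    omega

theorem eval_greenExpr (h : Fits w t N mm) {a : Mem} (hM : a.M ≤ N) (hx : a.x ≤ N) :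
    greenExpr.eval w (enc t mm N a) = cycleGreen a.M a.x := by
  have h3 := h.three_le
  have eM : EvalsTo w (enc t mm N a) (wvar 1) a.M := h.wvar (by omega) rfl (by omega)
  have ex : EvalsTo w (enc t mm N a) (wvar 9) a.x := h.wvar (by omega) rfl (by omega)
  simp only [greenExpr, RealExpr.eval, eM.1, ex.1, h.rconst (x := 1) (by omega),
    h.rconst (x := 2) (by omega), h.rconst (x := 12) (by omega), cycleGreen]
  norm_num

theorem eval_resolventExpr (h : Fits w t N mm) {a : Mem} (hn : a.n = N) (hM : a.M ≤ N)
    (hx : a.x ≤ a.M) (hR : ∀ i ≤ a.M, a.R i = a.r ^ i) :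
    resolventExpr.eval w (enc t mm N a) = cycleResolvent a.M a.r a.x := by
  have h3 := h.three_le
  have eM : EvalsTo w (enc t mm N a) (wvar 1) a.M := h.wvar (by omega) rfl (by omega)
  have ex : EvalsTo w (enc t mm N a) (wvar 9) a.x := h.wvar (by omega) rfl (by omega)
  have eR : ∀ {e : WordExpr} {i : ℕ}, EvalsTo w (enc t mm N a) e i → i ≤ a.M →
      (rvar (tableIndex e)).eval w (enc t mm N a) = a.r ^ i := fun he hi => by
    rw [eval_rvar h hn (evalsTo_tableIndex h he (by omega)) (by omega), ← hR _ hi]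
    rfl
  simp only [resolventExpr, RealExpr.eval, eR eM le_rfl, eR ex hx, eR (eM.sub ex) (Nat.sub_le _ _),
    h.rconst (x := 1) (by omega), eval_rvar h hn (h.const (x := 1) (by omega)) (by omega), Mem.aux,
    cycleResolvent, Nat.cast_one]

/-- The contribution of the mode number `k` to the output at the vertex number `z`. -/
noncomputable def contribution (mm : ℕ → ℕ) (t S q M J k : ℕ) (r : ℝ) (z : ℕ) : ℝ :=
  (S : ℝ) * (modeProd mm t J k z * axialValue M k r (digit mm z J) / (q : ℝ))

theorem steps_pointBody (h : Fits w t N mm) {a : Mem} (hn : a.n = N) (hz : a.z < N)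
    (hq : a.q ≤ N) (hk : a.k ≤ N) (hJ : a.J < t) (hM : a.M = mm a.J)
    (hR : ∀ i ≤ a.M, a.R i = a.r ^ i) {scale : WordExpr} {S : ℕ}
    (hS : ∀ a, EvalsTo w (enc t mm N a) scale S) (hc : scale.cost ≤ 10) :
    ∃ s kk zz x p, Steps w (pointBody scale) (enc t mm N a)
      (enc t mm N { a with
        g := Function.update a.g a.z
          (a.g a.z + contribution mm t S a.q a.M a.J a.k a.r a.z)
        z := a.z + 1
        s := s
        kk := kk
        zz := zz
        x := x
        p := p }) (t * 309 + 400) := by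
  have h3 := h.three_le
  obtain ⟨kk, zz, s1⟩ := steps_digits h hn hJ hk hz.le
  have hMN : a.M ≤ N := hM ▸ h.le _ hJ
  have hx : digit mm a.z a.J < a.M := by
    rw [hM]
    exact Nat.mod_lt _ (h.one_le _ hJ)
  let b : Mem := { a with
    p := modeProd mm t a.J a.k a.z
    x := digit mm a.z a.J
    kk := kk
    zz := zz
    s := t }
  have ek : EvalsTo w (enc t mm N b) (wvar 4) a.k := h.wvar (by omega) rfl (by omega)
  have s2 : Steps w (.ifWord (wvar 4) (accumulate scale resolventExpr)
      (accumulate scale greenExpr)) (enc t mm N b) (enc t mm N { b with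
        g := Function.update a.g a.z
          (a.g a.z + contribution mm t S a.q a.M a.J a.k a.r a.z) }) 250 := by
    unfold contribution axialValue
    by_cases hk0 : a.k = 0
    · rw [if_pos hk0]
      refine (Steps.ifWord_false (ek.1.trans hk0) (steps_accumulate (a := b) h hn hz hq hS
        (eval_greenExpr h hMN (hx.le.trans hMN)))).mono ?_
      simp only [greenExpr, rconst, wvar, wordAddr, WordExpr.cost, RealExpr.cost]
      omega
    · rw [if_neg hk0]
      refine (Steps.ifWord_true (fun h0 => hk0 (ek.1.symm.trans h0)) (steps_accumulate (a := b) h hn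
        hz hq hS (eval_resolventExpr h hn hMN hx.le hR))).mono ?_
      simp only [resolventExpr, rconst, rvar, tableIndex, realAddr, wvar, wordAddr, WordExpr.cost,
        RealExpr.cost]
      omega
  refine ⟨_, _, _, _, _, ((s1.seq (s2.seq (steps_incr (i := 5) (x := a.z) h (by omega) rfl
    hz.le))).mono ?_)⟩
  omega

/-- The function `g + c` on the numbers below `j`, and `g` elsewhere. -/
noncomputable def addBelow (g c : ℕ → ℝ) (j z : ℕ) : ℝ := if z < j then g z + c z else g z

theorem addBelow_zero (g c : ℕ → ℝ) : addBelow g c 0 = g := by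
  funext z
  exact if_neg (Nat.not_lt_zero z)

theorem addBelow_succ (g c : ℕ → ℝ) (j : ℕ) :
    Function.update (addBelow g c j) j (addBelow g c j j + c j) = addBelow g c (j + 1) := by
  funext z
  simp only [Function.update_apply, addBelow]
  rcases lt_trichotomy z j with hlt | rfl | hgt
  · rw [if_neg hlt.ne, if_pos hlt, if_pos (by omega)]
  · rw [if_pos rfl, if_neg (lt_irrefl _), if_pos (Nat.lt_succ_self _)]
  · rw [if_neg hgt.ne', if_neg (by omega), if_neg (by omega)]

theorem steps_points (h : Fits w t N mm) {a : Mem} (hn : a.n = N)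
    (hq : a.q ≤ N) (hk : a.k ≤ N) (hJ : a.J < t) (hM : a.M = mm a.J)
    (hR : ∀ i ≤ a.M, a.R i = a.r ^ i) {scale : WordExpr} {S : ℕ}
    (hS : ∀ a, EvalsTo w (enc t mm N a) scale S) (hc : scale.cost ≤ 10) :
    ∃ s kk zz x p, Steps w (points scale) (enc t mm N a)
      (enc t mm N { a with
        g := addBelow a.g (contribution mm t S a.q a.M a.J a.k a.r) N
        z := N
        s := s
        kk := kk
        zz := zz
        x := x
        p := p }) (N * (t * 309 + 420) + 50) := by
  have h3 := h.three_le
  have s1 := steps_assign (a := a) (i := 5) h (by omega) (h.const (x := 0) (by omega))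
  obtain ⟨σ', s2, s, kk, zz, x, p, rfl⟩ := Steps.while (w := w) (p := pointBody scale)
    (B := t * 309 + 400) (a := .lt (wvar 5) (wvar 0)) (N := N) (σ := enc t mm N (a.setVar 5 0))
    (fun j σ => ∃ s kk zz x p, σ = enc t mm N { a with
        g := addBelow a.g (contribution mm t S a.q a.M a.J a.k a.r) j
        z := j
        s := s
        kk := kk
        zz := zz
        x := x
        p := p })
    (fun j hj σ => by
      rintro ⟨s, kk, zz, x, p, rfl⟩
      exact lt_cond h.one_lt (h.wvar (by omega) rfl (by omega)) (h.wvar (by omega) hn (by omega)))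
    (fun j hj σ => by
      rintro ⟨s, kk, zz, x, p, rfl⟩
      obtain ⟨s', kk', zz', x', p', hs⟩ := steps_pointBody (a := { a with
        g := addBelow a.g (contribution mm t S a.q a.M a.J a.k a.r) j
        z := j
        s := s
        kk := kk
        zz := zz
        x := x
        p := p }) h hn hj hq hk hJ hM hR hS hc
      refine ⟨_, hs, s', kk', zz', x', p', ?_⟩
      congr 2
      exact addBelow_succ _ _ _)
    ⟨_, _, _, _, _, by rw [addBelow_zero]; rfl⟩
  refine ⟨s, kk, zz, x, p, (s1.seq s2).mono ?_⟩
  have e : t * 309 + 400 + (WordExpr.lt (wvar 5) (wvar 0)).cost + 1 ≤ t * 309 + 420 := by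
    simp only [wvar, wordAddr, WordExpr.cost]
    omega
  have e' := Nat.mul_le_mul_left N e
  simp only [wvar, wordAddr, WordExpr.cost] at e' ⊢
  omega

/-- The state of the variables after `k` modes. -/
def AfterModes (mm : ℕ → ℕ) (t N S M J q k : ℕ) (a : Mem) : Prop :=
  a.n = N ∧ a.M = M ∧ a.J = J ∧ a.q = q ∧ a.k = k ∧
    ∀ z < N, a.g z = ∑ i ∈ Finset.range k,
      contribution mm t S q M J i (smallRoot (eigValue mm t J i)) z

theorem steps_modeBody (h : Fits w t N mm) {S M J q k : ℕ} {a : Mem}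
    (ha : AfterModes mm t N S M J q k a)
    (hq : q ≤ N) (hk : k ≤ N) (hJ : J < t) (hM : M = mm J) {scale : WordExpr}
    (hS : ∀ a, EvalsTo w (enc t mm N a) scale S) (hc : scale.cost ≤ 10) :
    ∃ b, AfterModes mm t N S M J q (k + 1) b ∧
      Steps w (modeBody scale) (enc t mm N a) (enc t mm N b)
        (N * (t * 309 + 420) + t * 209 + N * 113 + 300) := by
  obtain ⟨hn, rfl, rfl, rfl, rfl, hg⟩ := ha
  have hMN : a.M ≤ N := hM ▸ h.le _ hJ
  have s1 := steps_eig (a := a) h hn hJ hk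
  have s2 := steps_root (a := { a with
        mu := eigValue mm t a.J a.k
        kk := a.k / ∏ i ∈ Finset.range t, redRadix mm a.J i
        s := t }) h hn
  have s3 : Steps w table _ _ (a.M * 113 + 50) := steps_table (a := { a with
        mu := eigValue mm t a.J a.k
        kk := a.k / ∏ i ∈ Finset.range t, redRadix mm a.J i
        s := t
        r := smallRoot (eigValue mm t a.J a.k) }) h hn hMN
  obtain ⟨s, kk, zz, x, p, s4⟩ := steps_points (a := { a with
        mu := eigValue mm t a.J a.k
        kk := a.k / ∏ i ∈ Finset.range t, redRadix mm a.J i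
        s := t
        r := smallRoot (eigValue mm t a.J a.k)
        R := powTable (smallRoot (eigValue mm t a.J a.k)) a.R a.M
        x := a.M }) h hn hq hk hJ hM (fun i hi => if_pos hi) hS hc
  have s5 := steps_incr (i := 4) (x := a.k) (a := { a with
        mu := eigValue mm t a.J a.k
        r := smallRoot (eigValue mm t a.J a.k)
        R := powTable (smallRoot (eigValue mm t a.J a.k)) a.R a.M
        g := addBelow a.g
          (contribution mm t S a.q a.M a.J a.k (smallRoot (eigValue mm t a.J a.k))) N
        z := N
        s := s
        kk := kk
        zz := zz
        x := x
        p := p }) h (by omega) rfl hk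
  refine ⟨_, ⟨?_, ?_, ?_, ?_, ?_, ?_⟩, (s1.seq (s2.seq (s3.seq (s4.seq s5)))).mono ?_⟩
  · exact hn
  · rfl
  · rfl
  · rfl
  · rfl
  · intro z hz
    rw [Finset.sum_range_succ, ← hg z hz]
    exact if_pos hz
  · omega

/-- The correctness of the program, and its running time. -/
theorem steps_greenProgram (h : Fits w t N mm) (ht : 0 < t)
    (hN : N = ∏ i ∈ Finset.range t, mm i) {scale : WordExpr} {S : ℕ}
    (hS : ∀ a, EvalsTo w (enc t mm N a) scale S) (hc : scale.cost ≤ 10) :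
    ∃ b, Steps w (greenProgram scale) (enc t mm N initMem) (enc t mm N b)
        (2000 * (t * N * (N / (longest mm t).1))) ∧
      ∀ z < N, b.g z = ∑ i ∈ Finset.range (N / (longest mm t).1),
        contribution mm t S (N / (longest mm t).1) (longest mm t).1 (longest mm t).2 i
          (smallRoot (eigValue mm t (longest mm t).2 i)) z := by
  obtain ⟨hJ, hM, -⟩ := longest_spec h le_rfl ht
  have s1 := steps_scan h hN
  have h3 := h.three_le
  have hMN := longest_fst_le h le_rfl
  set M := (longest mm t).1
  set J := (longest mm t).2
  have hM0 : 0 < M := hM ▸ h.one_le _ hJ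
  set q := N / M with hq
  have hqN : q ≤ N := Nat.div_le_self _ _
  have hq0 : 0 < q := Nat.div_pos hMN hM0
  obtain ⟨σ', s2, b, rfl, hb⟩ := Steps.while (w := w) (p := modeBody scale)
    (B := N * (t * 309 + 420) + t * 209 + N * 113 + 300) (a := .lt (wvar 4) (wvar 3)) (N := q)
    (σ := enc t mm N { initMem with n := N, M := M, J := J, q := q, s := t })
    (fun j σ => ∃ b, σ = enc t mm N b ∧ AfterModes mm t N S M J q j b)
    (fun j hj σ => by
      rintro ⟨b, rfl, -, -, -, h4, h5, -⟩
      exact lt_cond h.one_lt (h.wvar (by omega) h5 (by omega)) (h.wvar (by omega) h4 (by omega)))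
    (fun j hj σ => by
      rintro ⟨b, rfl, hb⟩
      obtain ⟨b', hb', hs⟩ := steps_modeBody h hb hqN (by omega) hJ hM.symm hS hc
      exact ⟨_, hs, b', rfl, hb'⟩)
    -- The mode counter and the output array are already zero in the initial memory.
    ⟨_, rfl, rfl, rfl, rfl, rfl, rfl, fun z _ => (Finset.sum_range_zero _).symm⟩
  refine ⟨b, (s1.seq s2).mono ?_, hb.2.2.2.2.2⟩
  have e : (WordExpr.lt (wvar 4) (wvar 3)).cost = 11 := rfl
  rw [e]
  -- All lower-order terms are absorbed into `t * N * q`.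
  have e1 : t ≤ t * N * q := by nlinarith [Nat.mul_pos (show 0 < N by omega) hq0]
  have e2 : N * q ≤ t * N * q := by nlinarith [Nat.mul_pos (show 0 < N by omega) hq0]
  have e3 : t * q ≤ t * N * q := by nlinarith [Nat.mul_pos ht hq0]
  have e4 : q ≤ N * q := Nat.le_mul_of_pos_left _ (by omega)
  have e5 : q * (N * (t * 309 + 420) + t * 209 + N * 113 + 300 + 11 + 1)
      = 309 * (t * N * q) + 533 * (N * q) + 209 * (t * q) + 312 * q := by ring
  rw [e5]
  omega

end Specs

/-! ### From mixed radix numbers to the torus, and the time bound -/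

section Correctness

variable {t : ℕ} {m : Fin t → ℕ}

/-- The lengths of the cycles, as a sequence. -/
def lengths (m : Fin t → ℕ) (i : ℕ) : ℕ := if h : i < t then m ⟨i, h⟩ else 0

theorem lengths_val (s : Fin t) : lengths m s = m s := dif_pos s.isLt

theorem initMem_var (i : ℕ) : initMem.var i = 0 := by
  unfold Mem.var
  split <;> rfl

/-- All cells outside the input are zero, so the layout is valid for every `N`, although the machine
has yet to compute it. -/
theorem inputState_eq_enc (N : ℕ) : inputState m = enc t (lengths m) N initMem := by
  simp only [inputState, enc, State.mk.injEq]
  constructor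
  · funext i
    rw [initMem_var]
    unfold lengths
    split_ifs
    all_goals first
      | rfl
      | omega
  · funext i
    have : initMem.aux (i - N) = 0 := by
      unfold Mem.aux
      split <;> rfl
    rw [this]
    split_ifs <;> rfl

theorem prod_range_lengths : ∏ i ∈ Finset.range t, lengths m i = ∏ s, m s := by
  rw [Finset.prod_range]
  exact Finset.prod_congr rfl fun s _ => lengths_val s

theorem three_pow_le_prod (hm : ∀ s, 3 ≤ m s) : 3 ^ t ≤ ∏ s, m s := by
  have := Finset.pow_card_le_prod Finset.univ m 3 fun s _ => hm s
  simpa using this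

theorem fits_of_pow_le {n w : ℕ} (ht : 1 ≤ t) (hm : ∀ s, 3 ≤ m s) (hn : n = ∏ s, m s)
    (hw : n ^ 6 ≤ 2 ^ w) : Fits w t n (lengths m) := by
  have h3 := three_pow_le_prod hm
  rw [← hn] at h3
  have h3n : 3 ≤ n := (Nat.le_self_pow (by omega) 3).trans h3
  refine ⟨h3n, (Nat.lt_pow_self (by norm_num)).le.trans h3, fun s hs => ?_, fun s hs => ?_, ?_⟩
  · have := hm ⟨s, hs⟩
    rw [lengths, dif_pos hs]
    omega
  · rw [lengths, dif_pos hs, hn]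
    exact Nat.le_of_dvd (hn ▸ by omega) (Finset.dvd_prod_of_mem m (Finset.mem_univ _))
  -- Since `100 ≤ 3 ^ 5`, the fifth power of `n` pays for the factor `100`; this is the origin of
  -- the exponent `6`.
  · have h5 : 3 ^ 5 ≤ n ^ 5 := Nat.pow_le_pow_left h3n 5
    calc 100 * n ≤ n ^ 5 * n := Nat.mul_le_mul_right n (by omega)
      _ = n ^ 6 := (pow_succ n 5).symm
      _ ≤ 2 ^ w := hw

/-- The inverse of `finPiFinEquiv` is by definition division with remainder, with coordinate `0`
least significant, exactly as the program extracts digits. -/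
theorem digit_finPiFinEquiv {f : ℕ → ℕ} (hf : ∀ s : Fin t, f s = m s) (d : ∀ s, Fin (m s))
    (s : Fin t) : digit f (finPiFinEquiv d) s = d s := by
  have h : ((finPiFinEquiv.symm (finPiFinEquiv d) : ∀ s, Fin (m s)) s : ℕ)
      = (finPiFinEquiv d : ℕ) / (∏ j : Fin s, m (Fin.castLE s.is_lt.le j)) % m s := rfl
  rw [Equiv.symm_apply_apply] at h
  rw [h, digit, hf, Finset.prod_range]
  congr 2
  exact Finset.prod_congr rfl fun j _ => hf (Fin.castLE s.is_lt.le j)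

theorem redRadix_val (J s : Fin t) : redRadix (lengths m) J s = reducedRadix m J s := by
  unfold redRadix reducedRadix
  simp only [lengths_val, Fin.ext_iff]

theorem sum_modes (J : Fin t) (F : (Fin t → ℕ) → ℝ) :
    ∑ k ∈ modes m J, F k = ∑ d : ∀ s, Fin (reducedRadix m J s), F fun s => d s := by
  symm
  refine Finset.sum_bij (fun d _ s => (d s : ℕ)) ?_ ?_ ?_ fun _ _ => rfl
  · exact fun d _ => Fintype.mem_piFinset.2 fun s => Finset.mem_range.2 (d s).isLt
  · exact fun d _ d' _ h => funext fun s => Fin.ext (congrFun h s)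
  · exact fun k hk => ⟨fun s => ⟨k s, Finset.mem_range.1 (Fintype.mem_piFinset.1 hk s)⟩,
      Finset.mem_univ _, rfl⟩

theorem finPiFinEquiv_eq_zero_iff (d : ∀ s, Fin (m s)) :
    (finPiFinEquiv d : ℕ) = 0 ↔ (fun s => (d s : ℕ)) = 0 := by
  constructor
  · intro h
    funext s
    rw [← digit_finPiFinEquiv (fun s => lengths_val s) d s, h, digit, Nat.zero_div, Nat.zero_mod]
    rfl
  · intro h
    rw [finPiFinEquiv_apply]
    refine Finset.sum_eq_zero fun s _ => ?_
    have : (d s : ℕ) = 0 := congrFun h s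
    rw [this, Nat.zero_mul]

theorem contribution_finPiFinEquiv (J : Fin t) (S q : ℕ) (k : ∀ s, Fin (reducedRadix m J s))
    (z : ∀ s, Fin (m s)) :
    contribution (lengths m) t S q (m J) J (finPiFinEquiv k)
        (smallRoot (eigValue (lengths m) t J (finPiFinEquiv k))) (finPiFinEquiv z)
      = (S : ℝ) * ((∏ s, mode (m s) (k s) (z s)) * axialGreen m J (fun s => k s) (z J) / (q : ℝ)) := by
  have hk := digit_finPiFinEquiv (fun s => redRadix_val J s) k
  have hz := digit_finPiFinEquiv (fun s => lengths_val s) z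
  have h1 : modeProd (lengths m) t J (finPiFinEquiv k) (finPiFinEquiv z)
      = ∏ s, mode (m s) (k s) (z s) := by
    rw [modeProd, Finset.prod_range]
    exact Finset.prod_congr rfl fun s _ => by rw [hk, hz, lengths_val]
  have h2 : eigValue (lengths m) t J (finPiFinEquiv k) = modeEigenvalue m fun s => k s := by
    rw [eigValue, Finset.sum_range]
    exact Finset.sum_congr rfl fun s _ => by rw [hk, lengths_val]
  rw [contribution, h1, h2, hz]
  unfold axialValue axialGreen
  simp only [finPiFinEquiv_eq_zero_iff]

/-- Radix `1` in direction `J` makes the numbers below `∏ s, reducedRadix m J s` enumerate precisely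
the modes with `k J = 0`. -/
theorem sum_contribution (J : Fin t) (S : ℕ) (z : ∀ s, Fin (m s)) :
    ∑ i ∈ Finset.range (∏ s, reducedRadix m J s),
      contribution (lengths m) t S (∏ s, reducedRadix m J s) (m J) J i
        (smallRoot (eigValue (lengths m) t J i)) (finPiFinEquiv z)
      = (S : ℝ) * torusRow m J fun s => z s := by
  rw [Finset.sum_range, ← Equiv.sum_comp (finPiFinEquiv (n := reducedRadix m J)),
    Finset.sum_congr rfl fun k _ => contribution_finPiFinEquiv J S _ k z, torusRow, sum_modes,
    ← Finset.mul_sum, ← Finset.sum_div, Nat.cast_prod]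

/-- The word expression for `LaplacianKind.factor (2 * t)`. -/
def scaleExpr : LaplacianKind → WordExpr
  | .combinatorial => .const 1
  | .normalized => .mul (.const 2) (.load (.const 0))
  | .discrete => .mul (.const 2) (.load (.const 0))

theorem evalsTo_scaleExpr {w N : ℕ} {mm : ℕ → ℕ} (h : Fits w t N mm) (κ : LaplacianKind) (a : Mem) :
    EvalsTo w (enc t mm N a) (scaleExpr κ) (κ.factor (2 * t)) := by
  have h3 := h.t_le
  cases κ with
  | combinatorial => exact h.const (by omega)
  | normalized | discrete =>
    exact (h.const (by omega)).mul (evalsTo_len h) (h.lt_of_le (by omega))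

/-- The hypothesis `n ≤ M ^ t` says $M\ge n^{1/t}$, so $n\lfloor n/M\rfloor\le n^2/n^{1/t}$. -/
theorem mul_div_le_rpow {n M : ℕ} (ht : 1 ≤ t) (hn : 0 < n) (hM0 : 0 < M) (hM : n ≤ M ^ t) :
    (n : ℝ) * ((n / M : ℕ) : ℝ) ≤ (n : ℝ) ^ (2 - 1 / (t : ℝ)) := by
  have hn' : (0 : ℝ) < n := by exact_mod_cast hn
  have hM' : (0 : ℝ) < M := by exact_mod_cast hM0
  have h1 : (n : ℝ) ^ (1 / (t : ℝ)) ≤ M := by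
    calc (n : ℝ) ^ (1 / (t : ℝ)) ≤ ((M : ℝ) ^ t) ^ (1 / (t : ℝ)) :=
          Real.rpow_le_rpow hn'.le (by exact_mod_cast hM) (by positivity)
      _ = M := by rw [one_div]; exact Real.pow_rpow_inv_natCast hM'.le (by omega)
  have h0 : 0 < (n : ℝ) ^ (1 / (t : ℝ)) := Real.rpow_pos_of_pos hn' _
  have h2 : (n : ℝ) ^ (2 : ℝ) = n * n := by
    rw [show (2 : ℝ) = ((2 : ℕ) : ℝ) by norm_num, Real.rpow_natCast, sq]
  rw [Real.rpow_sub hn', h2, mul_div_assoc]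
  refine mul_le_mul_of_nonneg_left ?_ hn'.le
  exact Nat.cast_div_le.trans (div_le_div_of_nonneg_left hn'.le h0 h1)

end Correctness

end RealRAM

open RealRAM in
theorem mainTheorem11 (κ : LaplacianKind) :
    ∃ (P : RealRAM.Program) (c : ℕ) (C : ℝ),
      ∀ (t : ℕ) (m : Fin t → ℕ) (n w : ℕ), 1 ≤ t → (∀ s, 3 ≤ m s) → n = ∏ s, m s →
        n ^ c ≤ 2 ^ w →
          ∃ (σ : RealRAM.State) (k : ℕ),
            RealRAM.Exec w P (RealRAM.inputState m) σ k ∧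
            (k : ℝ) ≤ C * ((t : ℝ) * (n : ℝ) ^ (2 - 1 / (t : ℝ)) * Real.log n) ∧
            matrixOfRow m σ = greenFunction (torus m) κ ∧
            IsPseudoInverse (laplacian (torus m) κ) (matrixOfRow m σ) := by
  refine ⟨greenProgram (scaleExpr κ), 6, 2000, fun t m n w ht hm hn hw => ?_⟩
  have h := fits_of_pow_le ht hm hn hw
  have hN : n = ∏ i ∈ Finset.range t, lengths m i := hn.trans prod_range_lengths.symm
  obtain ⟨b, ⟨k, hk, hrun⟩, hb⟩ := steps_greenProgram h ht hN (evalsTo_scaleExpr h κ)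
    (by cases κ <;> decide)
  obtain ⟨hJ, hM, hmax⟩ := longest_spec h le_rfl ht
  set J : Fin t := ⟨_, hJ⟩ with hJdef
  have hMJ : (longest (lengths m) t).1 = m J := hM.symm.trans (lengths_val J)
  have hM0 : 0 < m J := by have := hm J; omega
  have hq : n / m J = ∏ s, reducedRadix m J s := by
    rw [hn, ← mul_prod_reducedRadix m J, Nat.mul_div_cancel_left _ hM0]
  have hn3 := h.three_le
  rw [hMJ] at hk hb hmax
  refine ⟨_, k, inputState_eq_enc n ▸ hrun, ?_, ?_⟩
  · have hlen : n ≤ m J ^ t := by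
      rw [hn]
      have := Finset.prod_le_pow_card Finset.univ m (m J) fun s _ => by
        rw [← lengths_val (m := m) s]; exact hmax s s.isLt
      simpa using this
    have h1 := mul_div_le_rpow ht (by omega) hM0 hlen
    -- The logarithm is only used as a factor at least `1`, since `n ≥ 3 > e`.
    have hlog : 1 ≤ Real.log n := by
      rw [Real.le_log_iff_exp_le (by positivity)]
      have : (3 : ℝ) ≤ n := by exact_mod_cast hn3
      linarith [Real.exp_one_lt_d9]
    have hk' : (k : ℝ) ≤ 2000 * (t * (n * ((n / m J : ℕ) : ℝ))) := by
      rw [← mul_assoc (t : ℝ)]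
      exact_mod_cast hk
    refine hk'.trans (mul_le_mul_of_nonneg_left ?_ (by norm_num))
    have h2 : (t : ℝ) * (n * ((n / m J : ℕ) : ℝ)) ≤ t * (n : ℝ) ^ (2 - 1 / (t : ℝ)) :=
      mul_le_mul_of_nonneg_left h1 (Nat.cast_nonneg t)
    exact h2.trans (le_mul_of_one_le_right (by positivity) hlog)
  · have hX : matrixOfRow m (enc t (lengths m) n b) = (κ.factor (2 * t) : ℝ) • torusGreen m J := by
      ext x y
      have hlt : (finPiFinEquiv (absDiff x y) : ℕ) < n := by
        rw [hn]; exact (finPiFinEquiv (absDiff x y)).isLt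
      have e : matrixOfRow m (enc t (lengths m) n b) x y = b.g (finPiFinEquiv (absDiff x y)) :=
        if_pos hlt
      rw [e, hb _ hlt, hq]
      exact sum_contribution J _ (absDiff x y)
    rw [hX]
    obtain ⟨h1, h2⟩ := greenFunction_of_regular (torus m) κ (by omega) (torus_degree m hm)
      (torusGreen_isPseudoInverse hm J)
    exact ⟨h1.symm, h2⟩
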